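/- Let $d\ge 1$ and let $X_1,X_2,\dots$ be i.i.d. random vectors in $\mathbb{R}^d$ whose law has a density $f$ with respect to the Lebesgue measure. Let $\rho$ be the Euclidean distance, $B(x,r)$ the closed ball of center $x$ and radius $r$, $V_d=\pi^{d/2}/\Gamma(\frac d2+1)$ the volume of the unit ball, $\gamma=-\int_0^\infty e^{-t}\log t\,dt$ the Euler constant, $H=-\int_{\mathbb{R}^d} f(x)\log f(x)\,dx$ (with $0\log 0=0$) the entropy of $f$, and $S(f)=\{x: f(x)>0\}$. For $N\ge 2$ and $1\le i\le N$ put $\rho_i=\min\{\rho(X_i,X_j): 1\le j\le N,\ j\ne i\}$, and let $$H_N = d\log\big((\rho_1\cdots\rho_N)^{1/N}\big)+\log V_d+\gamma+\log(N-1)$$ be the Kozachenko–Leonenko estimate of $H$. Put $G(t)=0$ for $0\le t<1$ and $G(t)=t\log t$ for $t\ge1$; let $$M_f(x,R)=\sup_{0<r\le R}\frac{1}{r^dV_d}\int_{B(x,r)}f(y)\,dy,\qquad m_f(x,R)=\inf_{0<r\le R}\frac{1}{r^dV_d}\int_{B(x,r)}f(y)\,dy,$$ and define, with values in $[0,\infty]$,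 $$K_{f,2}(\varepsilon)=\int\Big(\int G\big(\log^2\rho(x,y)\big)f(y)\,dy\Big)^{1+\varepsilon}f(x)\,dx,$$ $$Q_f(\varepsilon,R)=\int M_f(x,R)^{\varepsilon}f(x)\,dx,\qquad T_f(\varepsilon,R)=\int m_f(x,R)^{-\varepsilon}f(x)\,dx .$$ Consider the conditions - (B): some version of the density $f$ satisfies $f(x)\le M$ for all $x\in\mathbb{R}^d$, with a constant $0<M<\infty$; - (C1): some version of the density $f$ satisfies $f(x)\ge m$ for all $x\in S(f)$, with a constant $m>0$. Assume that 1. $K_{f,2}(\varepsilon_0)<\infty$ for some $\varepsilon_0>0$, or $\mathsf{E}|\log\rho(X_1,X_2)|^p=\iint|\log\rho(x,y)|^p f(x)f(y)\,dx\,dy<\infty$ for some $p>2$; 2. $Q_f(\varepsilon_1,R_1)<\infty$ for some $\varepsilon_1,R_1>0$, or (B) holds; 3. $T_f(\varepsilon_2,R_2)<\infty$ for some $\varepsilon_2,R_2>0$, or (C1) holds. Then $\int f|\log f|\,dx<\infty$, so that $H$ is finite, and the estimates $H_N$ are $L^2$-consistent, i.e. $$\mathsf{E}(H_N-H)^2\to0,\qquad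 N\to\infty .$$ Moreover, the same conclusion holds whenever (B) and (C1) hold and $f$ has a bounded support $S(f)$ (for some version of $f$). -/

import Mathlib

open MeasureTheory ProbabilityTheory Filter Topology
open scoped ENNReal

noncomputable section

namespace KozachenkoLeonenko

/-- The Euclidean space of dimension `d`. -/
abbrev E (d : ℕ) : Type := EuclideanSpace ℝ (Fin d)

/-- `f` is a probability density with respect to the Lebesgue measure.
(`AEMeasurable f volume` is Lebesgue measurability.) -/
def IsProbDensity {d : ℕ} (f : E d → ℝ) : Prop :=
  AEMeasurable f volume ∧ (∀ x, 0 ≤ f x) ∧ ∫⁻ x, ENNReal.ofReal (f x) = 1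

/-- `g` is a version of the density `f`. -/
def IsVersion {d : ℕ} (g f : E d → ℝ) : Prop :=
  IsProbDensity g ∧ g =ᵐ[volume] f

/-- The support `S(f) = {x : f(x) > 0}`. -/
def densitySupport {d : ℕ} (f : E d → ℝ) : Set (E d) := {x | 0 < f x}

/-- The volume of the unit ball of `ℝ^d`. -/
def unitBallVolume (d : ℕ) : ℝ :=
  Real.pi ^ ((d : ℝ) / 2) / Real.Gamma ((d : ℝ) / 2 + 1)

/-- The Euler constant, as `-∫_{(0,∞)} e^{-t} log t dt`. -/
def eulerConstant : ℝ := -∫ t in Set.Ioi (0 : ℝ), Real.exp (-t) * Real.log t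

/-- The differential entropy `H(f) = -∫ f log f` (with `0 log 0 = 0`). -/
def entropy {d : ℕ} (f : E d → ℝ) : ℝ := -∫ x, f x * Real.log (f x)

/-- The integral that defines `H(f)` converges absolutely. -/
def HasFiniteEntropy {d : ℕ} (f : E d → ℝ) : Prop :=
  Integrable (fun x => f x * Real.log (f x)) volume

/-- The distance from the `i`-th point of a sample to its nearest neighbour among the other
points (a minimum over a finite set, non-empty when `2 ≤ N`). -/
def nearestDist {d N : ℕ} (x : Fin N → E d) (i : Fin N) : ℝ :=
  ⨅ j : {j : Fin N // j ≠ i}, dist (x i) (x j)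

/-- The Kozachenko - Leonenko estimate
`H_N = d log (ρ_1 ⋯ ρ_N)^{1/N} + log V_d + γ + log (N - 1)` of the entropy, meant for `2 ≤ N`.
Coinciding sample points, for which the logarithm would be `-∞`, have probability zero. -/
def klEstimate {d N : ℕ} (x : Fin N → E d) : ℝ :=
  d * Real.log ((∏ i, nearestDist x i) ^ (1 / (N : ℝ)))
    + Real.log (unitBallVolume d) + eulerConstant + Real.log ((N : ℝ) - 1)

/-- The function `G`: `0` for `t < 1`, and `t log t` for `t ≥ 1`. -/
def G (t : ℝ) : ℝ := if t < 1 then 0 else t * Real.log t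

/-- `I_f(x,r)`, the mean value of `f` over the closed ball of center `x` and radius `r`. -/
def ballMean {d : ℕ} (f : E d → ℝ) (x : E d) (r : ℝ) : ℝ≥0∞ :=
  (∫⁻ y in Metric.closedBall x r, ENNReal.ofReal (f y)) /
    ENNReal.ofReal (r ^ d * unitBallVolume d)

/-- `M_f(x,R)`. -/
def supMean {d : ℕ} (f : E d → ℝ) (x : E d) (R : ℝ) : ℝ≥0∞ :=
  ⨆ r ∈ Set.Ioc (0 : ℝ) R, ballMean f x r

/-- `m_f(x,R)`. -/
def infMean {d : ℕ} (f : E d → ℝ) (x : E d) (R : ℝ) : ℝ≥0∞ :=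
  ⨅ r ∈ Set.Ioc (0 : ℝ) R, ballMean f x r

/-- `K_{f,2}(ε) = ∫ (∫ G(log² ρ(x,y)) f(y) dy)^{1+ε} f(x) dx`. The diagonal `y = x` is negligible
in the inner integral. -/
def K₂ {d : ℕ} (f : E d → ℝ) (ε : ℝ) : ℝ≥0∞ :=
  ∫⁻ x, (∫⁻ y, ENNReal.ofReal (G (Real.log (dist x y) ^ 2)) * ENNReal.ofReal (f y)) ^ (1 + ε)
    * ENNReal.ofReal (f x)

/-- `Q_f(ε,R) = ∫ M_f(x,R)^ε f(x) dx`. -/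
def Q {d : ℕ} (f : E d → ℝ) (ε R : ℝ) : ℝ≥0∞ :=
  ∫⁻ x, supMean f x R ^ ε * ENNReal.ofReal (f x)

/-- `T_f(ε,R) = ∫ m_f(x,R)^{-ε} f(x) dx`, where `0^{-ε} = ∞`. -/
def T {d : ℕ} (f : E d → ℝ) (ε R : ℝ) : ℝ≥0∞ :=
  ∫⁻ x, infMean f x R ^ (-ε) * ENNReal.ofReal (f x)

/-- `∫∫ |log ρ(x,y)|^p f(x) f(y) dx dy`, that is `E |log ρ(X₁,X₂)|^p`. -/
def logMoment {d : ℕ} (f : E d → ℝ) (p : ℝ) : ℝ≥0∞ :=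
  ∫⁻ x, ∫⁻ y, ENNReal.ofReal (|Real.log (dist x y)| ^ p) *
    ENNReal.ofReal (f x) * ENNReal.ofReal (f y)

/-- Condition (B): some version of the density is bounded. -/
def CondB {d : ℕ} (f : E d → ℝ) : Prop :=
  ∃ g : E d → ℝ, IsVersion g f ∧ ∃ M : ℝ, 0 < M ∧ ∀ x, g x ≤ M

/-- Condition (C1): some version of the density is bounded away from zero on its support. -/
def CondC1 {d : ℕ} (f : E d → ℝ) : Prop :=
  ∃ g : E d → ℝ, IsVersion g f ∧ ∃ m : ℝ, 0 < m ∧ ∀ x ∈ densitySupport g, m ≤ g x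

/-- Some version of the density has a bounded support. -/
def HasBoundedSupport {d : ℕ} (f : E d → ℝ) : Prop :=
  ∃ g : E d → ℝ, IsVersion g f ∧ Bornology.IsBounded (densitySupport g)

/-- `E (H_N - H(f))² → 0` as `N → ∞`, the expectation being taken in `[0,∞]`. -/
def L2Consistent {d : ℕ} {Ω : Type*} [MeasurableSpace Ω] (P : Measure Ω)
    (X : ℕ → Ω → E d) (f : E d → ℝ) : Prop :=
  Tendsto
    (fun N : ℕ => ∫⁻ ω, ENNReal.ofReal
      ((klEstimate (fun i : Fin N => X i ω) - entropy f) ^ 2) ∂P)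
    atTop (𝓝 0)

end KozachenkoLeonenko

end

/-!
Write `ξ_i = log ((N - 1) V_d ρ_i ^ d)`, so that `H_N` is the mean of the `ξ_i` plus `γ`.

Given `X_i = x`, the event `ξ_i > s` says that a ball around `x` of volume `e ^ s / (N - 1)`
contains none of the other `N - 1` points; by Lebesgue's differentiation theorem its probability
tends to `exp (-f x * e ^ s)`. Hence `ξ_i` converges in law to `log τ - log (f X)`, where `τ` is a
standard exponential variable independent of `X`, and this limit has mean `H - γ`. Two such events
for distinct indices are asymptotically independent because the balls are eventually disjoint, so
the empirical tails converge in `L²`. Integrating over `s` gives the `L²` convergence of the means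
of the truncated variables `max (-A) (min ξ_i A)`.

The truncation is removed by a bound, uniform in `N`, for the tails of `ξ_i`. Small values of
`ρ_i` are controlled by the moment `Q_f` of the maximal function. For large values, cut a cube into
cells of the right size: an isolated sample point is alone in its cell, and a cell of mass `q`
contributes at most `q (1 - q) ^ k ≤ 1 / k`, where `k = N - 1`; outside the cube one uses the
second moment of `log (1 + ‖X‖)`.
-/

noncomputable section

namespace KozachenkoLeonenko

section RelativeFrequency

variable {Ω ι : Type*} [Fintype ι]

/-- The relative frequency with which the events of a finite family occur. -/
def relFreq (A : ι → Set Ω) (ω : Ω) : ℝ :=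
  (∑ i, (A i).indicator (1 : Ω → ℝ) ω) / Fintype.card ι

lemma relFreq_nonneg (A : ι → Set Ω) (ω : Ω) : 0 ≤ relFreq A ω :=
  div_nonneg (Finset.sum_nonneg fun _ _ => Set.indicator_nonneg (fun _ _ => zero_le_one) _)
    (Nat.cast_nonneg _)

lemma relFreq_le_one (A : ι → Set Ω) (ω : Ω) : relFreq A ω ≤ 1 := by
  refine div_le_one_of_le₀ ?_ (Nat.cast_nonneg _)
  calc ∑ i, (A i).indicator (1 : Ω → ℝ) ω ≤ ∑ _i : ι, (1 : ℝ) :=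
        Finset.sum_le_sum fun _ _ => Set.indicator_le_self' (fun _ _ => zero_le_one) ω
    _ = Fintype.card ι := by simp

variable [MeasurableSpace Ω] {P : Measure Ω} {A : ι → Set Ω}

lemma measurable_relFreq (hA : ∀ i, MeasurableSet (A i)) : Measurable (relFreq A) :=
  (Finset.measurable_fun_sum _ fun i _ => measurable_one.indicator (hA i)).div_const _

lemma memLp_relFreq [IsFiniteMeasure P] (hA : ∀ i, MeasurableSet (A i)) (p : ℝ≥0∞) :
    MemLp (relFreq A) p P :=
  .of_bound (measurable_relFreq hA).aestronglyMeasurable 1 <| ae_of_all _ fun ω => by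
    rw [Real.norm_of_nonneg (relFreq_nonneg A ω)]
    exact relFreq_le_one A ω

lemma integral_relFreq [IsFiniteMeasure P] [Nonempty ι] (hA : ∀ i, MeasurableSet (A i))
    {a : ℝ} (ha : ∀ i, P.real (A i) = a) : ∫ ω, relFreq A ω ∂P = a := by
  simp only [relFreq]
  rw [integral_div, integral_finsetSum _ fun i _ => (integrable_const 1).indicator (hA i)]
  simp [integral_indicator_one (hA _), ha]

variable [IsProbabilityMeasure P]

lemma integral_relFreq_sq_le [Nonempty ι] (hA : ∀ i, MeasurableSet (A i)) {b : ℝ} (hb : 0 ≤ b)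
    (hAb : ∀ i j, i ≠ j → P.real (A i ∩ A j) ≤ b) :
    ∫ ω, relFreq A ω ^ 2 ∂P ≤ 1 / Fintype.card ι + b := by
  classical
  have hpair (i j : ι) : P.real (A i ∩ A j) ≤ (if i = j then 1 else 0) + b := by
    split_ifs with h
    · exact measureReal_le_one.trans (by linarith)
    · simpa using hAb i j h
  have hint (i j : ι) : Integrable ((A i ∩ A j).indicator (1 : Ω → ℝ)) P :=
    (integrable_const 1).indicator ((hA i).inter (hA j))
  have hexpand (ω : Ω) : relFreq A ω ^ 2
      = (∑ i, ∑ j, (A i ∩ A j).indicator (1 : Ω → ℝ) ω) / Fintype.card ι ^ 2 := by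
    simp only [relFreq, div_pow, sq (Finset.sum _ _), Finset.sum_mul_sum, Set.inter_indicator_one,
      Pi.mul_apply]
  calc ∫ ω, relFreq A ω ^ 2 ∂P
      = (∑ i, ∑ j, P.real (A i ∩ A j)) / Fintype.card ι ^ 2 := by
        simp_rw [hexpand]
        rw [integral_div,
          integral_finsetSum _ fun i _ => integrable_finsetSum _ fun j _ => hint i j]
        simp_rw [integral_finsetSum _ fun j _ => hint _ j,
          integral_indicator_one ((hA _).inter (hA _))]
    _ ≤ (∑ i : ι, ∑ j : ι, ((if i = j then 1 else 0) + b)) / Fintype.card ι ^ 2 := by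
        gcongr with i _ j _
        exact hpair i j
    _ = 1 / Fintype.card ι + b := by
        simp only [Finset.sum_add_distrib, Finset.sum_ite_eq, Finset.mem_univ, if_true,
          Finset.sum_const, Finset.card_univ, nsmul_eq_mul]
        field_simp

lemma integral_relFreq_sub_sq_le [Nonempty ι] (hA : ∀ i, MeasurableSet (A i)) {a b : ℝ}
    (ha : ∀ i, P.real (A i) = a) (hb : 0 ≤ b) (hAb : ∀ i j, i ≠ j → P.real (A i ∩ A j) ≤ b)
    (c : ℝ) :
    ∫ ω, (relFreq A ω - c) ^ 2 ∂P ≤ 1 / Fintype.card ι + b - 2 * c * a + c ^ 2 := by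
  have hint : Integrable (relFreq A) P := (memLp_relFreq hA 1).integrable le_rfl
  have hint_sq : Integrable (fun ω => relFreq A ω ^ 2) P := (memLp_relFreq hA 2).integrable_sq
  calc ∫ ω, (relFreq A ω - c) ^ 2 ∂P
      = ∫ ω, (relFreq A ω ^ 2 - 2 * c * relFreq A ω + c ^ 2) ∂P := by
        congr with ω
        ring
    _ = ∫ ω, relFreq A ω ^ 2 ∂P - 2 * c * ∫ ω, relFreq A ω ∂P + c ^ 2 := by
        rw [integral_add (by exact hint_sq.sub (hint.const_mul _)) (integrable_const _),
          integral_sub hint_sq (hint.const_mul _), integral_const_mul]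
        simp
    _ ≤ 1 / Fintype.card ι + b - 2 * c * a + c ^ 2 := by
        rw [integral_relFreq hA ha]
        linarith [integral_relFreq_sq_le hA hb hAb]

end RelativeFrequency

lemma prodMk_preimage_lt_dist {α : Type*} [PseudoMetricSpace α] (x : α) (r : ℝ) :
    Prod.mk x ⁻¹' {p : α × α | r < dist p.1 p.2} = (Metric.closedBall x r)ᶜ := by
  ext y
  simp [dist_comm]

section Isolation

variable {α : Type*} [MeasurableSpace α]

/-- The law of a sample of `N` independent points with law `μ`. -/
abbrev sampleLaw (μ : Measure α) (N : ℕ) : Measure (Fin N → α) := Measure.pi fun _ => μ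

lemma measurePreserving_separate_two (μ : Measure α) [SigmaFinite μ] (n : ℕ) (i : Fin (n + 2))
    (k : Fin (n + 1)) :
    MeasurePreserving
      (fun x : Fin (n + 2) → α =>
        ((x i, x (i.succAbove k)), fun l => x (i.succAbove (k.succAbove l))))
      (sampleLaw μ (n + 2)) ((μ.prod μ).prod (sampleLaw μ n)) :=
  ((measurePreserving_prodAssoc μ μ _).symm MeasurableEquiv.prodAssoc).comp <|
    ((MeasurePreserving.id μ).prod (measurePreserving_piFinSuccAbove (fun _ => μ) k)).comp
      (measurePreserving_piFinSuccAbove (fun _ => μ) i)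

lemma measureReal_prod_eq_integral {β : Type*} [MeasurableSpace β] (ρ : Measure β)
    (μ : Measure α) [SFinite ρ] [IsFiniteMeasure μ] {S : Set (β × α)}
    (hS : NullMeasurableSet S (ρ.prod μ)) :
    (ρ.prod μ).real S = ∫ x, μ.real (Prod.mk x ⁻¹' S) ∂ρ := by
  obtain ⟨S', hS', hSS'⟩ := hS
  have hslice : ∀ᵐ x ∂ρ, (Prod.mk x ⁻¹' S : Set α) =ᵐ[μ] Prod.mk x ⁻¹' S' :=
    Measure.ae_ae_of_ae_prod hSS'
  rw [measureReal_congr hSS', integral_congr_ae (hslice.mono fun x hx => measureReal_congr hx)]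
  simp only [measureReal_def]
  rw [Measure.prod_apply hS', integral_toReal (measurable_measure_prodMk_left hS').aemeasurable
    (ae_of_all _ fun _ => measure_lt_top _ _)]

lemma measurableSet_forall_mem {β ι : Type*} [MeasurableSpace β] [Countable ι]
    {S : Set (β × α)} (hS : MeasurableSet S) :
    MeasurableSet {p : β × (ι → α) | ∀ k, (p.1, p.2 k) ∈ S} := by
  rw [Set.ofPred_forall]
  exact .iInter fun k => measurableSet_preimage (by fun_prop) hS

lemma measureReal_prod_pi_forall_mem {β ι : Type*} [MeasurableSpace β] [Fintype ι]
    (ρ : Measure β) (μ : Measure α) [SFinite ρ] [IsFiniteMeasure μ] {S : Set (β × α)}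
    (hS : MeasurableSet S) :
    (ρ.prod (Measure.pi fun _ : ι => μ)).real {p | ∀ k, (p.1, p.2 k) ∈ S}
      = ∫ x, μ.real (Prod.mk x ⁻¹' S) ^ Fintype.card ι ∂ρ := by
  have hslice (x : β) : Prod.mk x ⁻¹' {p : β × (ι → α) | ∀ k, (p.1, p.2 k) ∈ S}
      = Set.univ.pi fun _ => Prod.mk x ⁻¹' S := by
    ext
    simp
  rw [measureReal_prod_eq_integral ρ _ (measurableSet_forall_mem hS).nullMeasurableSet]
  simp [hslice, measureReal_def, Measure.pi_pi]

variable [PseudoMetricSpace α]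

variable (μ : Measure α)

/-- The probability that a random point has no neighbour within distance `r` among `k` other
points, all of them independent with law `μ`. -/
def isolProb (k : ℕ) (r : ℝ) : ℝ := ∫ x, μ.real (Metric.closedBall x r)ᶜ ^ k ∂μ

/-- The probability that two independent points with law `μ` are within distance `r`. -/
def closeProb (r : ℝ) : ℝ := (μ.prod μ).real {p | dist p.1 p.2 ≤ r}

lemma isolProb_nonneg (k : ℕ) (r : ℝ) : 0 ≤ isolProb μ k r :=
  integral_nonneg fun _ => by positivity

lemma closeProb_nonneg (r : ℝ) : 0 ≤ closeProb μ r := measureReal_nonneg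

lemma closeProb_mono [IsFiniteMeasure μ] {r s : ℝ} (h : r ≤ s) : closeProb μ r ≤ closeProb μ s :=
  measureReal_mono fun _ hp => le_trans hp h

variable [OpensMeasurableSpace α] [IsProbabilityMeasure μ]

lemma measureReal_compl_inter_compl_pow_le (n : ℕ) (r : ℝ) (x y : α) :
    μ.real ((Metric.closedBall x r)ᶜ ∩ (Metric.closedBall y r)ᶜ) ^ n
      ≤ μ.real (Metric.closedBall x r)ᶜ ^ n * μ.real (Metric.closedBall y r)ᶜ ^ n
        + {p : α × α | dist p.1 p.2 ≤ 2 * r}.indicator 1 (x, y) := by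
  rcases le_or_gt (dist x y) (2 * r) with hclose | hfar
  · rw [Set.indicator_of_mem (by exact hclose)]
    have hone : μ.real ((Metric.closedBall x r)ᶜ ∩ (Metric.closedBall y r)ᶜ) ^ n ≤ 1 :=
      pow_le_one₀ measureReal_nonneg measureReal_le_one
    exact hone.trans (le_add_of_nonneg_left (by positivity))
  · rw [Set.indicator_of_notMem (by exact hfar.not_ge), add_zero, ← mul_pow]
    refine pow_le_pow_left₀ measureReal_nonneg ?_ n
    have hball (z : α) : MeasurableSet (Metric.closedBall z r) :=
      Metric.isClosed_closedBall.measurableSet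
    have hdisj : Disjoint (Metric.closedBall x r) (Metric.closedBall y r) :=
      Metric.closedBall_disjoint_closedBall (by linarith)
    have hunion := measureReal_union (μ := μ) hdisj (hball y)
    rw [← Set.compl_union, probReal_compl_eq_one_sub ((hball x).union (hball y)), hunion,
      probReal_compl_eq_one_sub (hball x), probReal_compl_eq_one_sub (hball y)]
    nlinarith [measureReal_nonneg (μ := μ) (s := Metric.closedBall x r),
      measureReal_nonneg (μ := μ) (s := Metric.closedBall y r)]

variable [SecondCountableTopology α]

lemma measurableSet_lt_dist (r : ℝ) : MeasurableSet {p : α × α | r < dist p.1 p.2} :=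
  measurableSet_lt (by fun_prop) (by fun_prop)

lemma measurable_measureReal_compl_closedBall (r : ℝ) :
    Measurable fun x => μ.real (Metric.closedBall x r)ᶜ := by
  simp only [← prodMk_preimage_lt_dist]
  exact (measurable_measure_prodMk_left (measurableSet_lt_dist r)).ennreal_toReal

lemma integrable_measureReal_compl_closedBall_pow (k : ℕ) (r : ℝ) :
    Integrable (fun x => μ.real (Metric.closedBall x r)ᶜ ^ k) μ :=
  .of_bound ((measurable_measureReal_compl_closedBall μ r).pow_const k).aestronglyMeasurable 1 <|
    ae_of_all _ fun x => by
      rw [Real.norm_of_nonneg (by positivity)]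
      exact pow_le_one₀ measureReal_nonneg measureReal_le_one

lemma measureReal_prod_lt_dist (r : ℝ) :
    (μ.prod μ).real {p | r < dist p.1 p.2} = isolProb μ 1 r := by
  simp only [measureReal_prod_eq_integral μ μ (measurableSet_lt_dist r).nullMeasurableSet,
    prodMk_preimage_lt_dist, isolProb, pow_one]

lemma closeProb_eq_one_sub (r : ℝ) : closeProb μ r = 1 - isolProb μ 1 r := by
  rw [closeProb, ← measureReal_prod_lt_dist, ← probReal_compl_eq_one_sub (measurableSet_lt_dist r)]
  simp only [Set.compl_ofPred, not_lt]

lemma isolProb_le_succ_add_closeProb (k : ℕ) (r : ℝ) :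
    isolProb μ k r ≤ isolProb μ (k + 1) r + closeProb μ r := by
  set q : α → ℝ := fun x => μ.real (Metric.closedBall x r)ᶜ
  have hint (k : ℕ) : Integrable (fun x => q x ^ k) μ :=
    integrable_measureReal_compl_closedBall_pow μ k r
  have hdiff : isolProb μ k r - isolProb μ (k + 1) r ≤ 1 - isolProb μ 1 r := by
    calc isolProb μ k r - isolProb μ (k + 1) r
        = ∫ x, (q x ^ k - q x ^ (k + 1)) ∂μ := (integral_sub (hint k) (hint (k + 1))).symm
      _ ≤ ∫ x, (1 - q x ^ 1) ∂μ := by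
          refine integral_mono ((hint k).sub (hint (k + 1)))
            ((integrable_const 1).sub (hint 1)) fun x => ?_
          have hq : q x ≤ 1 := measureReal_le_one
          have hpow : q x ^ k ≤ 1 := pow_le_one₀ measureReal_nonneg hq
          simp only [pow_succ]
          nlinarith
      _ = 1 - isolProb μ 1 r := by
          rw [integral_sub (integrable_const 1) (hint 1)]
          simp [isolProb, q]
  linarith [closeProb_eq_one_sub μ r]

lemma isolProb_antitone (k : ℕ) : Antitone (isolProb μ k) := fun r s h =>
  integral_mono (integrable_measureReal_compl_closedBall_pow μ k s)
    (integrable_measureReal_compl_closedBall_pow μ k r) fun _ =>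
      pow_le_pow_left₀ measureReal_nonneg (measureReal_mono
        (Set.compl_subset_compl.2 (Metric.closedBall_subset_closedBall h))) k

lemma integral_compl_inter_compl_pow_le (n : ℕ) (r : ℝ) :
    ∫ p, μ.real ((Metric.closedBall p.1 r)ᶜ ∩ (Metric.closedBall p.2 r)ᶜ) ^ n ∂(μ.prod μ)
      ≤ isolProb μ n r ^ 2 + closeProb μ (2 * r) := by
  have hint := integrable_measureReal_compl_closedBall_pow μ n r
  have hclose : MeasurableSet {p : α × α | dist p.1 p.2 ≤ 2 * r} :=
    measurableSet_le (by fun_prop) (by fun_prop)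
  have hint_close : Integrable ({p : α × α | dist p.1 p.2 ≤ 2 * r}.indicator (1 : α × α → ℝ))
      (μ.prod μ) := (integrable_const 1).indicator hclose
  calc ∫ p, μ.real ((Metric.closedBall p.1 r)ᶜ ∩ (Metric.closedBall p.2 r)ᶜ) ^ n ∂(μ.prod μ)
      ≤ ∫ p, (μ.real (Metric.closedBall p.1 r)ᶜ ^ n * μ.real (Metric.closedBall p.2 r)ᶜ ^ n
          + {p : α × α | dist p.1 p.2 ≤ 2 * r}.indicator 1 p) ∂(μ.prod μ) :=
        integral_mono_of_nonneg (ae_of_all _ fun _ => by positivity)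
          ((hint.mul_prod hint).add hint_close)
          (ae_of_all _ fun p => measureReal_compl_inter_compl_pow_le μ n r p.1 p.2)
    _ = isolProb μ n r ^ 2 + closeProb μ (2 * r) := by
        rw [integral_add (hint.mul_prod hint) hint_close,
          integral_prod_mul (fun x => μ.real (Metric.closedBall x r)ᶜ ^ n) fun x =>
            μ.real (Metric.closedBall x r)ᶜ ^ n, integral_indicator_one hclose, isolProb, closeProb,
          sq]

lemma measure_prod_diagonal {α : Type*} [MeasurableSpace α] [MetricSpace α]
    [SecondCountableTopology α] [OpensMeasurableSpace α] (μ : Measure α) [SFinite μ]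
    [NullSingletonClass μ] : (μ.prod μ) (Set.diagonal α) = 0 := by
  have hslice (x : α) : Prod.mk x ⁻¹' Set.diagonal α = {x} := by
    ext y
    simp [eq_comm]
  simp [Measure.prod_apply measurableSet_diagonal, hslice]

lemma tendsto_closeProb {α : Type*} [MeasurableSpace α] [MetricSpace α]
    [SecondCountableTopology α] [OpensMeasurableSpace α] (μ : Measure α) [IsFiniteMeasure μ]
    [NullSingletonClass μ] : Tendsto (closeProb μ) (𝓝[>] 0) (𝓝 0) := by
  have hinter : ⋂ r > 0, {p : α × α | dist p.1 p.2 ≤ r} = Set.diagonal α := by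
    ext p
    simp only [Set.mem_iInter, Set.mem_ofPred_eq, Set.mem_diagonal_iff]
    exact ⟨fun h => dist_le_zero.1 (le_of_forall_gt_imp_ge_of_dense h), fun h r hr => by
      simpa [h] using hr.le⟩
  have hlim := tendsto_measure_biInter_gt (μ := μ.prod μ) (a := (0 : ℝ))
    (s := fun r => {p : α × α | dist p.1 p.2 ≤ r})
    (fun r _ => (measurableSet_le (by fun_prop) (by fun_prop)).nullMeasurableSet)
    (fun r s _ hrs _ hp => le_trans hp hrs) ⟨1, one_pos, measure_ne_top _ _⟩
  rw [hinter, measure_prod_diagonal] at hlim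
  exact (ENNReal.tendsto_toReal ENNReal.zero_ne_top).comp hlim

end Isolation

section NearestNeighbour

variable {d : ℕ}

lemma measurable_nearestDist {N : ℕ} (i : Fin N) :
    Measurable fun x : Fin N → E d => nearestDist x i :=
  Measurable.iInf fun j => (measurable_pi_apply i).dist (measurable_pi_apply j.1)

lemma measurableSet_lt_nearestDist {N : ℕ} (r : ℝ) (i : Fin N) :
    MeasurableSet {x : Fin N → E d | r < nearestDist x i} :=
  measurableSet_lt measurable_const (measurable_nearestDist i)

lemma nearestDist_le_dist {N : ℕ} (x : Fin N → E d) {i j : Fin N} (hij : j ≠ i) :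
    nearestDist x i ≤ dist (x i) (x j) :=
  ciInf_le (f := fun j : {j // j ≠ i} => dist (x i) (x j)) (Set.finite_range _).bddBelow ⟨j, hij⟩

lemma lt_nearestDist_iff {n : ℕ} (x : Fin (n + 2) → E d) (i : Fin (n + 2)) (r : ℝ) :
    r < nearestDist x i ↔ ∀ k : Fin (n + 1), r < dist (x i) (x (i.succAbove k)) := by
  refine ⟨fun h k => h.trans_le (nearestDist_le_dist x (i.succAbove_ne k)), fun h => ?_⟩
  have : Nonempty {j // j ≠ i} := ⟨⟨i.succAbove 0, i.succAbove_ne 0⟩⟩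
  obtain ⟨⟨j, hj⟩, hmin⟩ := exists_eq_ciInf_of_finite
    (f := fun j : {j // j ≠ i} => dist (x i) (x j))
  obtain ⟨k, rfl⟩ := Fin.exists_succAbove_eq hj
  exact (h k).trans_eq hmin

variable (μ : Measure (E d)) [IsProbabilityMeasure μ]

lemma sampleLaw_real_lt_nearestDist (n : ℕ) (i : Fin (n + 2)) (r : ℝ) :
    (sampleLaw μ (n + 2)).real {x | r < nearestDist x i} = isolProb μ (n + 1) r := by
  have hsep := measurePreserving_piFinSuccAbove (fun _ : Fin (n + 2) => μ) i
  have hprob := measureReal_prod_pi_forall_mem (ι := Fin (n + 1)) μ μ (measurableSet_lt_dist r)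
  simp only [prodMk_preimage_lt_dist, Fintype.card_fin] at hprob
  rw [isolProb, ← hprob, ← hsep.measureReal_preimage
    (measurableSet_forall_mem (measurableSet_lt_dist r)).nullMeasurableSet]
  simp only [lt_nearestDist_iff]
  rfl

lemma sampleLaw_real_lt_nearestDist_inter_le (n : ℕ) (r : ℝ) {i j : Fin (n + 2)} (hij : i ≠ j) :
    (sampleLaw μ (n + 2)).real ({x | r < nearestDist x i} ∩ {x | r < nearestDist x j})
      ≤ isolProb μ n r ^ 2 + closeProb μ (2 * r) := by
  obtain ⟨k, rfl⟩ := Fin.exists_succAbove_eq hij.symm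
  have hS : MeasurableSet {q : (E d × E d) × E d | r < dist q.1.1 q.2 ∧ r < dist q.1.2 q.2} := by
    rw [Set.ofPred_and]
    exact (measurableSet_lt (by fun_prop) (by fun_prop)).inter
      (measurableSet_lt (by fun_prop) (by fun_prop))
  have hslice (p : E d × E d) :
      Prod.mk p ⁻¹' {q : (E d × E d) × E d | r < dist q.1.1 q.2 ∧ r < dist q.1.2 q.2}
        = (Metric.closedBall p.1 r)ᶜ ∩ (Metric.closedBall p.2 r)ᶜ := by
    ext z
    simp [dist_comm]
  have hprob := measureReal_prod_pi_forall_mem (ι := Fin n) (μ.prod μ) μ hS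
  simp only [hslice, Fintype.card_fin] at hprob
  refine le_trans ?_ (hprob.trans_le (integral_compl_inter_compl_pow_le μ n r))
  rw [← (measurePreserving_separate_two μ n i k).measureReal_preimage
    (measurableSet_forall_mem hS).nullMeasurableSet]
  refine measureReal_mono fun x hx l => ⟨(lt_nearestDist_iff x i r).1 hx.1 _, ?_⟩
  exact hx.2.trans_le (nearestDist_le_dist x fun h =>
    k.succAbove_ne l (Fin.succAbove_right_injective h))

/-- The fraction of the sample points without a neighbour within distance `r`. -/
def isolFrac {N : ℕ} (r : ℝ) : (Fin N → E d) → ℝ :=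
  relFreq fun i => {x | r < nearestDist x i}

lemma integral_isolFrac_sub_sq_le (n : ℕ) {r : ℝ} (hr : 0 ≤ r) (c : ℝ) :
    ∫ x, (isolFrac r x - c) ^ 2 ∂(sampleLaw μ (n + 2))
      ≤ 1 / (n + 2 : ℝ) + ((isolProb μ (n + 1) r + closeProb μ (2 * r)) ^ 2 + closeProb μ (2 * r))
        - 2 * c * isolProb μ (n + 1) r + c ^ 2 := by
  have hisol : isolProb μ n r ≤ isolProb μ (n + 1) r + closeProb μ (2 * r) :=
    (isolProb_le_succ_add_closeProb μ n r).trans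
      (add_le_add_right (closeProb_mono μ (by linarith)) _)
  have hpair (i j : Fin (n + 2)) (hij : i ≠ j) :=
    (sampleLaw_real_lt_nearestDist_inter_le μ n r hij).trans
      (add_le_add_left (pow_le_pow_left₀ (isolProb_nonneg μ n r) hisol 2) _)
  simpa [isolFrac] using integral_relFreq_sub_sq_le (measurableSet_lt_nearestDist r)
    (fun i => sampleLaw_real_lt_nearestDist μ n i r)
    (add_nonneg (sq_nonneg _) (closeProb_nonneg μ _)) hpair c

end NearestNeighbour

section SmallBalls

variable {d : ℕ} {f : E d → ℝ}

lemma unitBallVolume_pos (d : ℕ) : 0 < unitBallVolume d :=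
  div_pos (Real.rpow_pos_of_pos Real.pi_pos _) (Real.Gamma_pos_of_pos (by positivity))

lemma volume_closedBall_eq (hd : 0 < d) (x : E d) {r : ℝ} (hr : 0 ≤ r) :
    volume (Metric.closedBall x r) = ENNReal.ofReal (r ^ d * unitBallVolume d) := by
  have : Nonempty (Fin d) := ⟨⟨0, hd⟩⟩
  rw [EuclideanSpace.volume_closedBall, Fintype.card_fin, ENNReal.ofReal_mul (pow_nonneg hr d),
    ENNReal.ofReal_pow hr, unitBallVolume, Real.sqrt_eq_rpow,
    ← Real.rpow_mul_natCast Real.pi_pos.le]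
  congr 4
  ring

/-- The radius `r` of the balls with `k V_d r^d = e^s`. -/
def radius (d k : ℕ) (s : ℝ) : ℝ := Real.exp ((s - Real.log k - Real.log (unitBallVolume d)) / d)

lemma radius_pos (d k : ℕ) (s : ℝ) : 0 < radius d k s := Real.exp_pos _

lemma measurable_radius (d k : ℕ) : Measurable (radius d k) := by
  unfold radius
  fun_prop

lemma mul_radius_pow_mul {k : ℕ} (hd : 0 < d) (hk : 0 < k) (s : ℝ) :
    k * (radius d k s ^ d * unitBallVolume d) = Real.exp s := by
  have hV := unitBallVolume_pos d
  rw [radius, ← Real.exp_nat_mul, mul_div_cancel₀ _ (by positivity), Real.exp_sub, Real.exp_sub,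
    Real.exp_log (by positivity), Real.exp_log hV]
  field_simp

lemma tendsto_radius (hd : 0 < d) (s : ℝ) :
    Tendsto (fun k : ℕ => radius d k s) atTop (𝓝[>] 0) := by
  refine tendsto_nhdsWithin_iff.2 ⟨?_, Eventually.of_forall fun k => radius_pos d k s⟩
  refine Real.tendsto_exp_atBot.comp (Tendsto.atBot_div_const (Nat.cast_pos.2 hd) ?_)
  refine tendsto_atBot_add_const_right _ _ (tendsto_atBot_add_const_left _ _ ?_)
  exact tendsto_neg_atTop_atBot.comp (Real.tendsto_log_atTop.comp tendsto_natCast_atTop_atTop)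

/-- The probability measure with density `f`. -/
def law (f : E d → ℝ) : Measure (E d) := volume.withDensity fun x => ENNReal.ofReal (f x)

lemma IsProbDensity.aemeasurable_ofReal (hf : IsProbDensity f) :
    AEMeasurable (fun x => ENNReal.ofReal (f x)) volume := hf.1.ennreal_ofReal

lemma IsProbDensity.isProbabilityMeasure_law (hf : IsProbDensity f) :
    IsProbabilityMeasure (law f) :=
  ⟨by rw [law, withDensity_apply _ MeasurableSet.univ, Measure.restrict_univ, hf.2.2]⟩

lemma law_absolutelyContinuous (f : E d → ℝ) : law f ≪ volume :=
  withDensity_absolutelyContinuous _ _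

lemma nullSingletonClass_law (hd : 0 < d) (f : E d → ℝ) : NullSingletonClass (law f) := by
  have : Nonempty (Fin d) := ⟨⟨0, hd⟩⟩
  exact ⟨fun x => law_absolutelyContinuous f (measure_singleton x)⟩

lemma IsProbDensity.ae_pos_law (hf : IsProbDensity f) : ∀ᵐ x ∂law f, 0 < f x := by
  rw [law, ae_withDensity_iff' hf.aemeasurable_ofReal]
  exact ae_of_all _ fun x hx => ENNReal.ofReal_pos.1 (pos_iff_ne_zero.2 hx)

lemma IsProbDensity.aemeasurable_law (hf : IsProbDensity f) : AEMeasurable f (law f) :=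
  hf.1.mono_ac (law_absolutelyContinuous f)

lemma IsProbDensity.lintegral_law (hf : IsProbDensity f) (g : E d → ℝ≥0∞) :
    ∫⁻ x, g x ∂law f = ∫⁻ x, g x * ENNReal.ofReal (f x) := by
  rw [law, lintegral_withDensity_eq_lintegral_mul_non_measurable₀ _ hf.aemeasurable_ofReal
    (ae_of_all _ fun x => ENNReal.ofReal_lt_top)]
  exact lintegral_congr fun x => mul_comm _ _

lemma IsProbDensity.integrable_law_iff (hf : IsProbDensity f) (g : E d → ℝ) :
    Integrable g (law f) ↔ Integrable (fun x => f x * g x) := by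
  rw [law, integrable_withDensity_iff_integrable_smul₀' hf.aemeasurable_ofReal
    (ae_of_all _ fun _ => ENNReal.ofReal_lt_top)]
  simp [ENNReal.toReal_ofReal (hf.2.1 _)]

lemma IsProbDensity.integral_law (hf : IsProbDensity f) (g : E d → ℝ) :
    ∫ x, g x ∂law f = ∫ x, f x * g x := by
  rw [law, integral_withDensity_eq_integral_toReal_smul₀ hf.aemeasurable_ofReal
    (ae_of_all _ fun _ => ENNReal.ofReal_lt_top)]
  simp [ENNReal.toReal_ofReal (hf.2.1 _)]

lemma law_closedBall (f : E d → ℝ) (x : E d) (r : ℝ) :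
    law f (Metric.closedBall x r) = ∫⁻ y in Metric.closedBall x r, ENNReal.ofReal (f y) :=
  withDensity_apply _ Metric.isClosed_closedBall.measurableSet

lemma law_closedBall_eq_ballMean (f : E d → ℝ) (x : E d) {r : ℝ} (hr : 0 < r) :
    law f (Metric.closedBall x r) = ballMean f x r * ENNReal.ofReal (r ^ d * unitBallVolume d) := by
  have hvol : 0 < r ^ d * unitBallVolume d := mul_pos (pow_pos hr d) (unitBallVolume_pos d)
  rw [ballMean, ENNReal.div_mul_cancel (by simpa using hvol) ENNReal.ofReal_ne_top, law_closedBall]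

lemma law_real_closedBall_eq (f : E d → ℝ) (x : E d) {r : ℝ} (hr : 0 < r) :
    (law f).real (Metric.closedBall x r)
      = (ballMean f x r).toReal * (r ^ d * unitBallVolume d) := by
  rw [measureReal_def, law_closedBall_eq_ballMean f x hr, ENNReal.toReal_mul,
    ENNReal.toReal_ofReal (mul_pos (pow_pos hr d) (unitBallVolume_pos d)).le]

lemma IsProbDensity.ae_tendsto_ballMean (hd : 0 < d) (hf : IsProbDensity f) :
    ∀ᵐ x : E d, Tendsto (ballMean f x) (𝓝[>] 0) (𝓝 (ENNReal.ofReal (f x))) := by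
  have := hf.isProbabilityMeasure_law
  filter_upwards [Besicovitch.ae_tendsto_rnDeriv (law f) volume,
    Measure.rnDeriv_withDensity₀ volume hf.aemeasurable_ofReal] with x hx hrn
  rw [← law] at hrn
  rw [hrn] at hx
  refine hx.congr' ?_
  filter_upwards [self_mem_nhdsWithin] with r hr
  rw [ballMean, law_closedBall, volume_closedBall_eq hd x (le_of_lt hr)]

lemma IsProbDensity.ae_tendsto_measureReal_compl_closedBall_pow (hd : 0 < d)
    (hf : IsProbDensity f) (s : ℝ) :
    ∀ᵐ x ∂law f,
      Tendsto (fun k : ℕ => (law f).real (Metric.closedBall x (radius d k s))ᶜ ^ k) atTop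
        (𝓝 (Real.exp (-(f x * Real.exp s)))) := by
  have := hf.isProbabilityMeasure_law
  filter_upwards [(law_absolutelyContinuous f).ae_le (hf.ae_tendsto_ballMean hd)] with x hx
  have hmean : Tendsto (fun r => (ballMean f x r).toReal) (𝓝[>] 0) (𝓝 (f x)) := by
    simpa only [ENNReal.toReal_ofReal (hf.2.1 x), Function.comp_def] using
      (ENNReal.tendsto_toReal ENNReal.ofReal_ne_top).comp hx
  simp_rw [probReal_compl_eq_one_sub Metric.isClosed_closedBall.measurableSet, sub_eq_add_neg]
  refine Real.tendsto_one_add_pow_exp_of_tendsto ?_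
  refine ((hmean.comp (tendsto_radius hd s)).mul_const (Real.exp s)).neg.congr' ?_
  filter_upwards [eventually_gt_atTop 0] with k hk
  rw [law_real_closedBall_eq f x (radius_pos d k s), ← mul_radius_pow_mul hd hk s,
    Function.comp_apply]
  ring

lemma IsProbDensity.tendsto_isolProb (hd : 0 < d) (hf : IsProbDensity f) (s : ℝ) :
    Tendsto (fun k => isolProb (law f) k (radius d k s)) atTop
      (𝓝 (∫ x, Real.exp (-(f x * Real.exp s)) ∂law f)) := by
  have := hf.isProbabilityMeasure_law
  refine tendsto_integral_of_dominated_convergence (fun _ => 1)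
    (fun k => (integrable_measureReal_compl_closedBall_pow _ k _).aestronglyMeasurable)
    (integrable_const _) (fun k => ae_of_all _ fun x => ?_)
    (hf.ae_tendsto_measureReal_compl_closedBall_pow hd s)
  rw [Real.norm_of_nonneg (by positivity)]
  exact pow_le_one₀ measureReal_nonneg measureReal_le_one

end SmallBalls

section Truncation

/-- Truncation to the interval `[-A, A]`. -/
def clamp (A t : ℝ) : ℝ := max (-A) (min t A)

lemma continuous_clamp (A : ℝ) : Continuous (clamp A) := by
  unfold clamp
  fun_prop

lemma abs_clamp_le {A : ℝ} (hA : 0 ≤ A) (t : ℝ) : |clamp A t| ≤ |t| := by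
  grind [clamp]

lemma abs_clamp_le_abs (A t : ℝ) : |clamp A t| ≤ |A| := by
  grind [clamp]

lemma abs_sub_clamp {A : ℝ} (hA : 0 ≤ A) (t : ℝ) : |t - clamp A t| = max (|t| - A) 0 := by
  grind [clamp]

lemma tendsto_clamp (t : ℝ) : Tendsto (fun A => clamp A t) atTop (𝓝 t) := by
  refine tendsto_const_nhds.congr' ?_
  filter_upwards [eventually_ge_atTop |t|] with A hA
  grind [clamp]

lemma clamp_eq_measureReal_Iio (A t : ℝ) :
    clamp A t = -A + (volume.restrict (Set.Ioc (-A) A)).real (Set.Iio t) := by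
  rw [measureReal_congr Iio_ae_eq_Iic, measureReal_restrict_apply measurableSet_Iic,
    Set.inter_comm, Set.Ioc_inter_Iic, Real.volume_real_Ioc]
  grind [clamp]

lemma integral_clamp (ν : Measure ℝ) [IsProbabilityMeasure ν] (A : ℝ) :
    ∫ t, clamp A t ∂ν = -A + ∫ s in Set.Ioc (-A) A, ν.real (Set.Ioi s) := by
  set lam : Measure ℝ := volume.restrict (Set.Ioc (-A) A)
  have hle : MeasurableSet {p : ℝ × ℝ | p.1 < p.2} := measurableSet_lt (by fun_prop) (by fun_prop)
  have hge : MeasurableSet {p : ℝ × ℝ | p.2 < p.1} := measurableSet_lt (by fun_prop) (by fun_prop)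
  have hswap : ∫ t, lam.real (Set.Iio t) ∂ν = ∫ s, ν.real (Set.Ioi s) ∂lam :=
    calc ∫ t, lam.real (Set.Iio t) ∂ν = (ν.prod lam).real {p | p.2 < p.1} :=
          (measureReal_prod_eq_integral ν lam hge.nullMeasurableSet).symm
      _ = (lam.prod ν).real {p | p.1 < p.2} :=
          (Measure.measurePreserving_swap.measureReal_preimage hge.nullMeasurableSet).symm
      _ = ∫ s, ν.real (Set.Ioi s) ∂lam :=
          measureReal_prod_eq_integral lam ν hle.nullMeasurableSet
  have hint : Integrable (fun t => lam.real (Set.Iio t)) ν :=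
    .of_bound (Monotone.measurable fun s t h =>
        measureReal_mono (Set.Iio_subset_Iio h)).aestronglyMeasurable (lam.real Set.univ) <|
      ae_of_all _ fun t => by
        rw [Real.norm_of_nonneg measureReal_nonneg]
        exact measureReal_mono (Set.subset_univ _)
  simp_rw [clamp_eq_measureReal_Iio]
  rw [integral_add (integrable_const _) hint, hswap]
  simp

lemma tendsto_integral_clamp {ν : Measure ℝ} (hν : Integrable id ν) :
    Tendsto (fun A => ∫ t, clamp A t ∂ν) atTop (𝓝 (∫ t, t ∂ν)) := by
  refine tendsto_integral_filter_of_dominated_convergence (fun t => |t|)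
    (Eventually.of_forall fun A => (continuous_clamp A).aestronglyMeasurable) ?_ hν.abs
    (ae_of_all _ tendsto_clamp)
  filter_upwards [eventually_ge_atTop 0] with A hA
  exact ae_of_all _ fun t => abs_clamp_le hA t

end Truncation

section MeanSquare

lemma sq_integral_le {β : Type*} [MeasurableSpace β] (ν : Measure β) [IsFiniteMeasure ν]
    {g : β → ℝ} (hg : Integrable g ν) (hg2 : Integrable (fun b => g b ^ 2) ν) :
    (∫ b, g b ∂ν) ^ 2 ≤ ν.real Set.univ * ∫ b, g b ^ 2 ∂ν := by
  rcases eq_or_ne ν 0 with rfl | hν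
  · simp
  have : NeZero ν := ⟨hν⟩
  have hmass : 0 < ν.real Set.univ := ENNReal.toReal_pos (by simpa using hν) (measure_ne_top _ _)
  have hjensen := (even_two.convexOn_pow (𝕜 := ℝ)).map_average_le (by fun_prop) isClosed_univ
    (ae_of_all ν fun b => Set.mem_univ (g b)) hg hg2
  simp only [average_eq, smul_eq_mul, mul_pow, inv_pow] at hjensen
  field_simp at hjensen
  linarith

lemma tendsto_integral_sq_integral {Ω : ℕ → Type*} [∀ n, MeasurableSpace (Ω n)]
    {P : ∀ n, Measure (Ω n)} [∀ n, IsProbabilityMeasure (P n)] {β : Type*} [MeasurableSpace β]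
    {ν : Measure β} [IsFiniteMeasure ν] {D : ∀ n, Ω n → β → ℝ}
    (hD : ∀ n, Measurable (Function.uncurry (D n))) (hD1 : ∀ n ω b, |D n ω b| ≤ 1)
    (hlim : ∀ b, Tendsto (fun n => ∫ ω, D n ω b ^ 2 ∂P n) atTop (𝓝 0)) :
    Tendsto (fun n => ∫ ω, (∫ b, D n ω b ∂ν) ^ 2 ∂P n) atTop (𝓝 0) := by
  have hsq (n : ℕ) (ω : Ω n) (b : β) : ‖D n ω b ^ 2‖ ≤ 1 := by
    simpa using hD1 n ω b
  have hprod (n : ℕ) :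
      Integrable (Function.uncurry fun ω b => D n ω b ^ 2) ((P n).prod ν) :=
    .of_bound ((hD n).pow_const 2).aestronglyMeasurable 1 <| ae_of_all _ fun p => hsq n p.1 p.2
  have hlim' : Tendsto (fun n => ν.real Set.univ * ∫ b, ∫ ω, D n ω b ^ 2 ∂P n ∂ν) atTop (𝓝 0) := by
    rw [← mul_zero (ν.real Set.univ), ← integral_zero β ℝ (μ := ν)]
    refine (tendsto_integral_of_dominated_convergence (fun _ => 1)
      (fun n => (hprod n).swap.integral_prod_left.aestronglyMeasurable) (integrable_const _)
      (fun n => ae_of_all _ fun b => ?_) (ae_of_all _ hlim)).const_mul _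
    simpa using norm_integral_le_of_norm_le_const (ae_of_all (P n) fun ω => hsq n ω b)
  refine squeeze_zero (fun n => integral_nonneg fun _ => sq_nonneg _) (fun n => ?_) hlim'
  rw [← integral_integral_swap (hprod n), ← integral_const_mul]
  refine integral_mono_of_nonneg (ae_of_all _ fun _ => sq_nonneg _)
    ((hprod n).integral_prod_left.const_mul _) (ae_of_all _ fun ω => ?_)
  exact sq_integral_le ν
    (.of_bound ((hD n).comp measurable_prodMk_left).aestronglyMeasurable 1
      (ae_of_all _ fun b => hD1 n ω b))
    (.of_bound (((hD n).comp measurable_prodMk_left).pow_const 2).aestronglyMeasurable 1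
      (ae_of_all _ fun b => hsq n ω b))

end MeanSquare

section LimitLaw

lemma expMeasure_one :
    expMeasure 1 = (volume.restrict (Set.Ioi 0)).withDensity fun t => .ofReal (Real.exp (-t)) := by
  rw [← withDensity_indicator measurableSet_Ioi]
  refine withDensity_congr_ae ?_
  filter_upwards [compl_mem_ae_iff.2 (measure_singleton (0 : ℝ))] with t ht
  rcases lt_or_gt_of_ne ht with hneg | hpos
  · simp [Set.indicator, not_lt.2 hneg.le, gammaPDF_of_neg hneg]
  · simp [Set.indicator, hpos, gammaPDF_of_nonneg hpos.le]

lemma integral_expMeasure_one (g : ℝ → ℝ) :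
    ∫ t, g t ∂expMeasure 1 = ∫ t in Set.Ioi (0 : ℝ), Real.exp (-t) * g t := by
  rw [expMeasure_one, integral_withDensity_eq_integral_toReal_smul (by fun_prop)
    (ae_of_all _ fun _ => ENNReal.ofReal_lt_top)]
  simp [ENNReal.toReal_ofReal (Real.exp_pos _).le]

lemma integrable_expMeasure_one_iff (g : ℝ → ℝ) :
    Integrable g (expMeasure 1)
      ↔ IntegrableOn (fun t => Real.exp (-t) * g t) (Set.Ioi 0) := by
  rw [expMeasure_one, integrable_withDensity_iff_integrable_smul' (by fun_prop)
    (ae_of_all _ fun _ => ENNReal.ofReal_lt_top)]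
  simp [ENNReal.toReal_ofReal (Real.exp_pos _).le, IntegrableOn]

lemma ae_pos_expMeasure_one : ∀ᵐ t ∂expMeasure 1, 0 < t := by
  rw [expMeasure_one]
  exact (withDensity_absolutelyContinuous _ _).ae_le (ae_restrict_mem measurableSet_Ioi)

lemma expMeasure_one_real_Ioi {a : ℝ} (ha : 0 ≤ a) :
    (expMeasure 1).real (Set.Ioi a) = Real.exp (-a) := by
  have := isProbabilityMeasure_expMeasure one_pos
  rw [← Set.compl_Iic, probReal_compl_eq_one_sub measurableSet_Iic, ← cdf_eq_real,
    cdf_expMeasure_eq one_pos, if_pos ha]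
  simp

lemma abs_log_le_add_rpow {t : ℝ} (ht : 0 < t) : |Real.log t| ≤ t + 2 * t ^ (-(1 / 2) : ℝ) := by
  have hpow : 0 < t ^ (-(1 / 2) : ℝ) := Real.rpow_pos_of_pos ht _
  have hlog := Real.log_le_sub_one_of_pos ht
  have hlog_pow := Real.log_le_sub_one_of_pos hpow
  rw [Real.log_rpow ht] at hlog_pow
  exact abs_le.2 ⟨by linarith, by linarith⟩

lemma integrable_log_expMeasure_one : Integrable Real.log (expMeasure 1) := by
  rw [integrable_expMeasure_one_iff]
  have hΓ2 := Real.GammaIntegral_convergent (s := 2) two_pos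
  have hΓhalf := Real.GammaIntegral_convergent (s := 1 / 2) (by norm_num)
  refine Integrable.mono' (hΓ2.add (hΓhalf.const_mul 2)) (by fun_prop) ?_
  filter_upwards [ae_restrict_mem measurableSet_Ioi] with t ht
  calc ‖Real.exp (-t) * Real.log t‖ = Real.exp (-t) * |Real.log t| := by simp
    _ ≤ Real.exp (-t) * (t + 2 * t ^ (-(1 / 2) : ℝ)) := by
        gcongr
        exact abs_log_le_add_rpow ht
    _ = Real.exp (-t) * t ^ (2 - 1 : ℝ) + 2 * (Real.exp (-t) * t ^ (1 / 2 - 1 : ℝ)) := by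
        norm_num
        ring

lemma integral_log_expMeasure_one : ∫ t, Real.log t ∂expMeasure 1 = -eulerConstant := by
  rw [integral_expMeasure_one, eulerConstant, neg_neg]

variable {d : ℕ} {f : E d → ℝ}

/-- The law of `log τ - log f(X)`, where `X` has density `f` and `τ` is an independent standard
exponential variable: the limit law of the logarithm of the volume of the nearest neighbour ball
multiplied by the sample size. -/
def limitLaw (f : E d → ℝ) : Measure ℝ :=
  ((law f).prod (expMeasure 1)).map fun p => Real.log p.2 - Real.log (f p.1)

lemma IsProbDensity.aemeasurable_log_sub_log (hf : IsProbDensity f) :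
    AEMeasurable (fun p : E d × ℝ => Real.log p.2 - Real.log (f p.1))
      ((law f).prod (expMeasure 1)) :=
  have := isProbabilityMeasure_expMeasure one_pos
  (Real.measurable_log.comp measurable_snd).aemeasurable.sub hf.aemeasurable_law.log.comp_fst

lemma IsProbDensity.isProbabilityMeasure_limitLaw (hf : IsProbDensity f) :
    IsProbabilityMeasure (limitLaw f) :=
  have := hf.isProbabilityMeasure_law
  have := isProbabilityMeasure_expMeasure one_pos
  Measure.isProbabilityMeasure_map hf.aemeasurable_log_sub_log

lemma IsProbDensity.limitLaw_real_Ioi (hf : IsProbDensity f) (s : ℝ) :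
    (limitLaw f).real (Set.Ioi s) = ∫ x, Real.exp (-(f x * Real.exp s)) ∂law f := by
  have := hf.isProbabilityMeasure_law
  have := isProbabilityMeasure_expMeasure one_pos
  have hmeas := hf.aemeasurable_log_sub_log
  rw [limitLaw, map_measureReal_apply_of_aemeasurable hmeas measurableSet_Ioi,
    measureReal_prod_eq_integral _ _ (hmeas.nullMeasurable measurableSet_Ioi)]
  refine integral_congr_ae ?_
  filter_upwards [hf.ae_pos_law] with x hx
  rw [← expMeasure_one_real_Ioi (by positivity)]
  refine measureReal_congr ?_
  filter_upwards [ae_pos_expMeasure_one] with t ht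
  refine propext (?_ : s < Real.log t - Real.log (f x) ↔ f x * Real.exp s < t)
  rw [lt_sub_iff_add_lt, Real.lt_log_iff_exp_lt ht, Real.exp_add, Real.exp_log hx, mul_comm]

lemma IsProbDensity.integrable_id_limitLaw (hf : IsProbDensity f) (hH : HasFiniteEntropy f) :
    Integrable id (limitLaw f) := by
  have := hf.isProbabilityMeasure_law
  have := isProbabilityMeasure_expMeasure one_pos
  rw [limitLaw, integrable_map_measure aestronglyMeasurable_id hf.aemeasurable_log_sub_log]
  exact (integrable_log_expMeasure_one.comp_snd _).sub
    (((hf.integrable_law_iff _).2 hH).comp_fst _)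

lemma IsProbDensity.integral_limitLaw (hf : IsProbDensity f) (hH : HasFiniteEntropy f) :
    ∫ t, t ∂limitLaw f = entropy f - eulerConstant := by
  have := hf.isProbabilityMeasure_law
  have := isProbabilityMeasure_expMeasure one_pos
  rw [limitLaw, integral_map hf.aemeasurable_log_sub_log (by fun_prop),
    integral_sub (integrable_log_expMeasure_one.comp_snd _)
      (((hf.integrable_law_iff _).2 hH).comp_fst _),
    integral_fun_snd, integral_fun_fst fun x => Real.log (f x), integral_log_expMeasure_one,
    hf.integral_law, entropy]
  simp
  ring

end LimitLaw

section TruncatedMeans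

variable {d : ℕ} {f : E d → ℝ}

lemma IsProbDensity.tendsto_integral_isolFrac_sub_sq (hd : 0 < d) (hf : IsProbDensity f) (s : ℝ) :
    Tendsto (fun n : ℕ => ∫ x, (isolFrac (radius d (n + 1) s) x - (limitLaw f).real (Set.Ioi s)) ^ 2
      ∂sampleLaw (law f) (n + 2)) atTop (𝓝 0) := by
  have := hf.isProbabilityMeasure_law
  have := nullSingletonClass_law hd f
  have hshift := tendsto_add_atTop_nat 1
  have hrecip : Tendsto (fun n : ℕ => 1 / ((n : ℝ) + 2)) atTop (𝓝 0) := by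
    exact tendsto_const_nhds.div_atTop
      (tendsto_atTop_add_const_right _ (2 : ℝ) tendsto_natCast_atTop_atTop)
  have hisol := (hf.tendsto_isolProb hd s).comp hshift
  have hclose : Tendsto (fun n : ℕ => closeProb (law f) (2 * radius d (n + 1) s)) atTop (𝓝 0) := by
    refine (tendsto_closeProb (law f)).comp (tendsto_nhdsWithin_iff.2
      ⟨?_, Eventually.of_forall fun n => mul_pos two_pos (radius_pos d _ s)⟩)
    simpa using (((tendsto_radius hd s).comp hshift).mono_right nhdsWithin_le_nhds).const_mul 2
  rw [← hf.limitLaw_real_Ioi] at hisol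
  set c := (limitLaw f).real (Set.Ioi s)
  have hbound := ((hrecip.add (((hisol.add hclose).pow 2).add hclose)).sub
    (hisol.const_mul (2 * c))).add_const (c ^ 2)
  rw [show (0 : ℝ) + ((c + 0) ^ 2 + 0) - 2 * c * c + c ^ 2 = 0 by ring] at hbound
  exact squeeze_zero (fun n => integral_nonneg fun x => sq_nonneg _)
    (fun n => integral_isolFrac_sub_sq_le (law f) n (radius_pos d (n + 1) s).le c) hbound

/-- The logarithm of the volume of the nearest neighbour ball of the `i`-th sample point,
multiplied by the number of the other points. -/
def logSpacing {n : ℕ} (x : Fin (n + 2) → E d) (i : Fin (n + 2)) : ℝ :=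
  Real.log (n + 1 : ℕ) + Real.log (unitBallVolume d) + d * Real.log (nearestDist x i)

lemma measurable_logSpacing {n : ℕ} (i : Fin (n + 2)) :
    Measurable fun x : Fin (n + 2) → E d => logSpacing x i :=
  ((measurable_nearestDist i).log.const_mul _).const_add _

lemma radius_lt_nearestDist_iff (hd : 0 < d) {n : ℕ} {x : Fin (n + 2) → E d} {i : Fin (n + 2)}
    (h : 0 < nearestDist x i) (s : ℝ) :
    radius d (n + 1) s < nearestDist x i ↔ s < logSpacing x i := by
  rw [radius, ← Real.lt_log_iff_exp_lt h, div_lt_iff₀ (Nat.cast_pos.2 hd), logSpacing]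
  constructor <;> intro h <;> linarith

lemma IsProbDensity.ae_nearestDist_pos (hd : 0 < d) (hf : IsProbDensity f) (n : ℕ) :
    ∀ᵐ x ∂sampleLaw (law f) (n + 2), ∀ i, 0 < nearestDist x i := by
  have := hf.isProbabilityMeasure_law
  have := nullSingletonClass_law hd f
  refine ae_all_iff.2 fun i => (mem_ae_iff_prob_eq_one (measurableSet_lt_nearestDist 0 i)).2 ?_
  have hprob := sampleLaw_real_lt_nearestDist (law f) n i 0
  rw [← ENNReal.ofReal_toReal (measure_ne_top _ _), ← measureReal_def, hprob]
  simp [isolProb, probReal_compl_eq_one_sub (measurableSet_singleton _), measureReal_def]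

lemma mean_clamp_logSpacing (hd : 0 < d) {n : ℕ} (A : ℝ) {x : Fin (n + 2) → E d}
    (h : ∀ i, 0 < nearestDist x i) :
    (∑ i, clamp A (logSpacing x i)) / (n + 2 : ℕ)
      = -A + ∫ s in Set.Ioc (-A) A, isolFrac (radius d (n + 1) s) x := by
  have hevent (i : Fin (n + 2)) :
      (fun s => {x : Fin (n + 2) → E d | radius d (n + 1) s < nearestDist x i}.indicator
        (1 : (Fin (n + 2) → E d) → ℝ) x) = (Set.Iio (logSpacing x i)).indicator 1 := by
    ext s
    simp [Set.indicator, radius_lt_nearestDist_iff hd (h i)]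
  simp_rw [isolFrac, relFreq]
  rw [integral_div, integral_finsetSum]
  · simp_rw [hevent, integral_indicator_one measurableSet_Iio, clamp_eq_measureReal_Iio,
      Finset.sum_add_distrib, add_div]
    simp
    field_simp
  · intro i _
    rw [hevent]
    exact (integrable_const 1).indicator measurableSet_Iio

lemma measurable_uncurry_isolFrac (n : ℕ) :
    Measurable (Function.uncurry fun (x : Fin (n + 2) → E d) s =>
      isolFrac (radius d (n + 1) s) x) := by
  refine (Finset.measurable_fun_sum _ fun i _ => ?_).div_const _
  have hS : MeasurableSet {p : (Fin (n + 2) → E d) × ℝ |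
      radius d (n + 1) p.2 < nearestDist p.1 i} :=
    measurableSet_lt ((measurable_radius d (n + 1)).comp measurable_snd)
      ((measurable_nearestDist i).comp measurable_fst)
  exact measurable_one.indicator hS

lemma IsProbDensity.tendsto_integral_mean_clamp_sub_sq (hd : 0 < d) (hf : IsProbDensity f) (A : ℝ) :
    Tendsto (fun n : ℕ => ∫ x, ((∑ i, clamp A (logSpacing x i)) / (n + 2 : ℕ)
      - ∫ t, clamp A t ∂limitLaw f) ^ 2 ∂sampleLaw (law f) (n + 2)) atTop (𝓝 0) := by
  have := hf.isProbabilityMeasure_law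
  have := hf.isProbabilityMeasure_limitLaw
  have htail : Measurable fun s => (limitLaw f).real (Set.Ioi s) :=
    Antitone.measurable fun s t h => measureReal_mono (Set.Ioi_subset_Ioi h)
  have hfrac (n : ℕ) (x : Fin (n + 2) → E d) (s : ℝ) :
      isolFrac (radius d (n + 1) s) x ∈ Set.Icc 0 1 := ⟨relFreq_nonneg _ _, relFreq_le_one _ _⟩
  have hdiff := tendsto_integral_sq_integral
    (P := fun n => sampleLaw (law f) (n + 2)) (ν := volume.restrict (Set.Ioc (-A) A))
    (fun n => (measurable_uncurry_isolFrac n).sub (htail.comp measurable_snd))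
    (fun n x s => (abs_sub_le_of_le_of_le (hfrac n x s).1 (hfrac n x s).2
      measureReal_nonneg measureReal_le_one).trans_eq (sub_zero 1))
    (hf.tendsto_integral_isolFrac_sub_sq hd)
  refine hdiff.congr fun n => integral_congr_ae ?_
  filter_upwards [hf.ae_nearestDist_pos hd n] with x hx
  rw [mean_clamp_logSpacing hd A hx, integral_clamp, add_sub_add_left_eq_sub]
  congr 1
  refine integral_sub (.of_bound ((measurable_uncurry_isolFrac n).comp
    measurable_prodMk_left).aestronglyMeasurable 1 ?_)
    (.of_bound htail.aestronglyMeasurable 1 ?_)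
  · exact ae_of_all _ fun s => by
      simpa [abs_of_nonneg (hfrac n x s).1] using (hfrac n x s).2
  · exact ae_of_all _ fun s => by
      rw [Real.norm_of_nonneg measureReal_nonneg]
      exact measureReal_le_one

end TruncatedMeans

section MomentConditions

lemma log_one_add_add_le {a b : ℝ} (ha : 0 ≤ a) (hb : 0 ≤ b) :
    Real.log (1 + (a + b)) ≤ Real.log (1 + a) + Real.log (1 + b) := by
  rw [← Real.log_mul (by positivity) (by positivity)]
  exact Real.log_le_log (by positivity) (by nlinarith)

lemma log_one_add_le {t : ℝ} (ht : 0 ≤ t) : Real.log (1 + t) ≤ Real.log 2 + |Real.log t| := by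
  rcases le_total t 1 with h | h
  · have : Real.log (1 + t) ≤ Real.log 2 := Real.log_le_log (by positivity) (by linarith)
    linarith [abs_nonneg (Real.log t)]
  · calc Real.log (1 + t) ≤ Real.log (2 * t) := Real.log_le_log (by positivity) (by linarith)
      _ = Real.log 2 + Real.log t := Real.log_mul two_ne_zero (by positivity)
      _ ≤ Real.log 2 + |Real.log t| := by gcongr; exact le_abs_self _

lemma log_one_add_norm_sq_le {F : Type*} [SeminormedAddCommGroup F] (x y : F) :
    Real.log (1 + ‖y‖) ^ 2
      ≤ 2 * ((Real.log (1 + ‖x‖) + Real.log 2) ^ 2 + Real.log (dist x y) ^ 2) := by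
  have hnorm : ‖y‖ ≤ ‖x‖ + dist x y := by
    rw [dist_comm, dist_eq_norm]
    exact norm_le_insert' y x
  have hlog : Real.log (1 + ‖y‖) ≤ Real.log (1 + ‖x‖) + Real.log 2 + |Real.log (dist x y)| := by
    have hmono : Real.log (1 + ‖y‖) ≤ Real.log (1 + (‖x‖ + dist x y)) := by gcongr
    linarith [log_one_add_add_le (norm_nonneg x) (dist_nonneg (x := x) (y := y)),
      log_one_add_le (dist_nonneg (x := x) (y := y))]
  calc Real.log (1 + ‖y‖) ^ 2
      ≤ (Real.log (1 + ‖x‖) + Real.log 2 + |Real.log (dist x y)|) ^ 2 := by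
        gcongr
        exact Real.log_nonneg (by linarith [norm_nonneg y])
    _ ≤ _ := by
        rw [← sq_abs (Real.log (dist x y))]
        exact add_sq_le

lemma le_exp_one_add_G (u : ℝ) : u ≤ Real.exp 1 + G u := by
  have he : 1 < Real.exp 1 := Real.one_lt_exp_iff.2 one_pos
  unfold G
  split_ifs with h
  · linarith
  · rw [not_lt] at h
    rcases le_total u (Real.exp 1) with hu | hu
    · nlinarith [Real.log_nonneg h]
    · nlinarith [(Real.le_log_iff_exp_le (by linarith)).2 hu]

lemma sq_le_one_add_abs_rpow {p : ℝ} (hp : 2 ≤ p) (l : ℝ) : l ^ 2 ≤ 1 + |l| ^ p := by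
  have hpow : 0 ≤ |l| ^ p := Real.rpow_nonneg (abs_nonneg l) p
  rw [← sq_abs]
  rcases le_total |l| 1 with h | h
  · linarith [pow_le_one₀ (n := 2) (abs_nonneg l) h]
  · have := Real.rpow_le_rpow_of_exponent_le h hp
    rw [Real.rpow_two] at this
    linarith

variable {d : ℕ} {f : E d → ℝ}

/-- The law with density `f` has a finite second logarithmic moment: a consequence of each of the
alternative moment conditions on the distance of two sample points. -/
def HasLogSqMoment (f : E d → ℝ) : Prop :=
  ∫⁻ y, ENNReal.ofReal (Real.log (1 + ‖y‖) ^ 2) ∂law f < ∞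

lemma IsProbDensity.exists_lt_top (hf : IsProbDensity f) {Φ : E d → ℝ≥0∞}
    (h : ∫⁻ x, Φ x * ENNReal.ofReal (f x) < ∞) : ∃ x, Φ x < ∞ := by
  have := hf.isProbabilityMeasure_law
  by_contra! htop
  rw [← hf.lintegral_law] at h
  simp [fun x => top_le_iff.1 (htop x)] at h

lemma IsProbDensity.hasLogSqMoment_of_log_dist_sq_le (hf : IsProbDensity f) {x : E d} {C : ℝ}
    {φ : E d → ℝ} (hle : ∀ y, Real.log (dist x y) ^ 2 ≤ C + φ y)
    (hfin : ∫⁻ y, ENNReal.ofReal (φ y) * ENNReal.ofReal (f y) < ∞) : HasLogSqMoment f := by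
  have := hf.isProbabilityMeasure_law
  rw [← hf.lintegral_law] at hfin
  set D := 2 * ((Real.log (1 + ‖x‖) + Real.log 2) ^ 2 + C)
  calc ∫⁻ y, ENNReal.ofReal (Real.log (1 + ‖y‖) ^ 2) ∂law f
      ≤ ∫⁻ y, ENNReal.ofReal D + ENNReal.ofReal 2 * ENNReal.ofReal (φ y) ∂law f := by
        refine lintegral_mono fun y => ?_
        rw [← ENNReal.ofReal_mul two_pos.le]
        refine le_trans (ENNReal.ofReal_le_ofReal ?_) ENNReal.ofReal_add_le
        linarith [log_one_add_norm_sq_le x y, hle y]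
    _ = ENNReal.ofReal D + ENNReal.ofReal 2 * ∫⁻ y, ENNReal.ofReal (φ y) ∂law f := by
        rw [lintegral_add_left measurable_const, lintegral_const_mul' _ _ ENNReal.ofReal_ne_top]
        simp
    _ < ∞ := ENNReal.add_lt_top.2
        ⟨ENNReal.ofReal_lt_top, ENNReal.mul_lt_top ENNReal.ofReal_lt_top hfin⟩

lemma IsProbDensity.hasLogSqMoment_of_K₂ (hf : IsProbDensity f) {ε : ℝ} (hε : -1 < ε)
    (h : K₂ f ε < ∞) : HasLogSqMoment f := by
  obtain ⟨x, hx⟩ := hf.exists_lt_top h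
  rw [ENNReal.rpow_lt_top_iff_of_pos (by linarith)] at hx
  exact hf.hasLogSqMoment_of_log_dist_sq_le (fun y => le_exp_one_add_G _) hx

lemma IsProbDensity.hasLogSqMoment_of_logMoment (hf : IsProbDensity f) {p : ℝ} (hp : 2 ≤ p)
    (h : logMoment f p < ∞) : HasLogSqMoment f := by
  have hfactor : logMoment f p = ∫⁻ x, (∫⁻ y, ENNReal.ofReal (|Real.log (dist x y)| ^ p) *
      ENNReal.ofReal (f y)) * ENNReal.ofReal (f x) := by
    refine lintegral_congr fun x => ?_
    rw [← lintegral_mul_const' _ _ ENNReal.ofReal_ne_top]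
    exact lintegral_congr fun y => mul_right_comm _ _ _
  obtain ⟨x, hx⟩ := hf.exists_lt_top (hfactor ▸ h)
  exact hf.hasLogSqMoment_of_log_dist_sq_le (fun y => sq_le_one_add_abs_rpow hp _) hx

lemma HasBoundedSupport.hasLogSqMoment (hf : IsProbDensity f) (h : HasBoundedSupport f) :
    HasLogSqMoment f := by
  have := hf.isProbabilityMeasure_law
  obtain ⟨g, ⟨-, hgf⟩, hbdd⟩ := h
  obtain ⟨R, hR⟩ := hbdd.exists_norm_le
  have hae : ∀ᵐ y ∂law f, ENNReal.ofReal (Real.log (1 + ‖y‖) ^ 2)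
      ≤ ENNReal.ofReal (Real.log (1 + R) ^ 2) := by
    filter_upwards [hf.ae_pos_law, (law_absolutelyContinuous f).ae_le hgf] with y hy hgy
    have hyR : ‖y‖ ≤ R := hR y (hy.trans_eq hgy.symm)
    have hlog : 0 ≤ Real.log (1 + ‖y‖) := Real.log_nonneg (by linarith [norm_nonneg y])
    gcongr
  exact (lintegral_mono_ae hae).trans_lt (by simp)

lemma CondB.exists_Q_lt_top (hd : 0 < d) (hf : IsProbDensity f) (h : CondB f) :
    ∃ ε R : ℝ, 0 < ε ∧ 0 < R ∧ Q f ε R < ∞ := by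
  obtain ⟨g, ⟨-, hgf⟩, M, -, hM⟩ := h
  have hsup (x : E d) : supMean f x 1 ≤ ENNReal.ofReal M := by
    refine iSup₂_le fun r hr => ENNReal.div_le_of_le_mul ?_
    rw [← volume_closedBall_eq hd x hr.1.le, ← setLIntegral_const]
    refine lintegral_mono_ae (ae_restrict_of_ae ?_)
    filter_upwards [hgf] with y hy
    exact ENNReal.ofReal_le_ofReal (hy ▸ hM y)
  refine ⟨1, 1, one_pos, one_pos, ?_⟩
  calc Q f 1 1 ≤ ∫⁻ x, ENNReal.ofReal M * ENNReal.ofReal (f x) :=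
        lintegral_mono fun x => by
          rw [ENNReal.rpow_one]
          gcongr
          exact hsup x
    _ = ENNReal.ofReal M := by
        rw [lintegral_const_mul' _ _ ENNReal.ofReal_ne_top, hf.2.2, mul_one]
    _ < ∞ := ENNReal.ofReal_lt_top

lemma IsProbDensity.Q_min_one_lt_top (hf : IsProbDensity f) {ε R : ℝ} (hε : 0 ≤ ε)
    (hQ : Q f ε R < ∞) : Q f (min ε 1) R < ∞ := by
  have := hf.isProbabilityMeasure_law
  rw [Q, ← hf.lintegral_law] at hQ ⊢
  calc ∫⁻ x, supMean f x R ^ min ε 1 ∂law f ≤ ∫⁻ x, 1 + supMean f x R ^ ε ∂law f := by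
        refine lintegral_mono fun x => ?_
        rcases le_total (supMean f x R) 1 with h | h
        · exact (ENNReal.rpow_le_one h (le_min hε zero_le_one)).trans le_self_add
        · exact (ENNReal.rpow_le_rpow_of_exponent_le h (min_le_left _ _)).trans le_add_self
    _ = 1 + ∫⁻ x, supMean f x R ^ ε ∂law f := by
        rw [lintegral_add_left measurable_const]
        simp
    _ < ∞ := ENNReal.add_lt_top.2 ⟨ENNReal.one_lt_top, hQ⟩

lemma ballMean_le_supMean (f : E d → ℝ) (x : E d) {r R : ℝ} (hr : r ∈ Set.Ioc 0 R) :
    ballMean f x r ≤ supMean f x R :=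
  le_iSup₂ (f := fun r (_ : r ∈ Set.Ioc (0 : ℝ) R) => ballMean f x r) r hr

lemma IsProbDensity.ae_ofReal_le_supMean (hd : 0 < d) (hf : IsProbDensity f) {R : ℝ}
    (hR : 0 < R) : ∀ᵐ x : E d, ENNReal.ofReal (f x) ≤ supMean f x R := by
  filter_upwards [hf.ae_tendsto_ballMean hd] with x hx
  refine le_of_tendsto hx ?_
  filter_upwards [Ioc_mem_nhdsGT hR] with r hr
  exact ballMean_le_supMean f x hr

lemma IsProbDensity.integrable_rpow_law (hd : 0 < d) (hf : IsProbDensity f) {ε R : ℝ}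
    (hε : 0 ≤ ε) (hR : 0 < R) (hQ : Q f ε R < ∞) : Integrable (fun x => f x ^ ε) (law f) := by
  refine ⟨(hf.aemeasurable_law.pow_const ε).aestronglyMeasurable, ?_⟩
  rw [hasFiniteIntegral_iff_ofReal (ae_of_all _ fun x => Real.rpow_nonneg (hf.2.1 x) _)]
  rw [Q, ← hf.lintegral_law] at hQ
  refine (lintegral_mono_ae ?_).trans_lt hQ
  filter_upwards [(law_absolutelyContinuous f).ae_le (hf.ae_ofReal_le_supMean hd hR)] with x hx
  rw [← ENNReal.ofReal_rpow_of_nonneg (hf.2.1 x) hε]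
  exact ENNReal.rpow_le_rpow hx hε

lemma HasLogSqMoment.integrable_log_one_add_norm (hf : IsProbDensity f) (h : HasLogSqMoment f) :
    Integrable (fun x => Real.log (1 + ‖x‖)) (law f) := by
  have := hf.isProbabilityMeasure_law
  have hmeas : Measurable fun x : E d => Real.log (1 + ‖x‖) := by fun_prop
  refine MemLp.integrable one_le_two
    ((memLp_two_iff_integrable_sq hmeas.aestronglyMeasurable).2
      ⟨(hmeas.pow_const 2).aestronglyMeasurable, ?_⟩)
  rwa [hasFiniteIntegral_iff_ofReal (ae_of_all _ fun x => sq_nonneg _)]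

lemma IsProbDensity.integrable_div_law (hf : IsProbDensity f) {g : E d → ℝ} (hg : Integrable g) :
    Integrable (fun x => g x / f x) (law f) := by
  rw [hf.integrable_law_iff]
  refine hg.mono (hf.1.mul (hg.aemeasurable.div hf.1)).aestronglyMeasurable
    (ae_of_all _ fun x => ?_)
  rcases eq_or_ne (f x) 0 with h | h
  · simp [h]
  · rw [mul_div_cancel₀ _ h]

lemma abs_log_le_rpow_div_add {a g ε : ℝ} (ha : 0 < a) (hg : 0 < g) (hg1 : g ≤ 1) (hε : 0 < ε) :
    |Real.log a| ≤ a ^ ε / ε + g / a - Real.log g := by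
  have hupper : Real.log a ≤ a ^ ε / ε := Real.log_le_rpow_div ha.le hε
  have hlower : Real.log g - Real.log a ≤ g / a := by
    rw [← Real.log_div hg.ne' ha.ne']
    exact Real.log_le_self (div_pos hg ha).le
  have hpow : 0 ≤ a ^ ε / ε := by positivity
  have hdiv : 0 ≤ g / a := by positivity
  have hlog : Real.log g ≤ 0 := Real.log_nonpos hg.le hg1
  exact abs_le.2 ⟨by linarith, by linarith⟩

lemma IsProbDensity.hasFiniteEntropy (hd : 0 < d) (hf : IsProbDensity f)
    (hlog : HasLogSqMoment f) {ε R : ℝ} (hε : 0 < ε) (hR : 0 < R) (hQ : Q f ε R < ∞) :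
    HasFiniteEntropy f := by
  -- As `g` is Lebesgue integrable, `log (g / f) ≤ g / f` bounds `log f` from below.
  set g : E d → ℝ := fun x => (1 + ‖x‖) ^ (-((d : ℝ) + 1)) with hg
  have hlogg (x : E d) : -Real.log (g x) = ((d : ℝ) + 1) * Real.log (1 + ‖x‖) := by
    rw [hg, Real.log_rpow (by positivity), neg_mul, neg_neg]
  refine (hf.integrable_law_iff fun x => Real.log (f x)).1 ?_
  refine (((hf.integrable_rpow_law hd hε.le hR hQ).div_const ε).add
    (hf.integrable_div_law (integrable_one_add_norm (by simp)) : Integrable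
      (fun x => g x / f x) (law f))).add ((hlog.integrable_log_one_add_norm hf).const_mul (d + 1))
    |>.mono' hf.aemeasurable_law.log.aestronglyMeasurable ?_
  filter_upwards [hf.ae_pos_law] with x hx
  rw [Pi.add_apply, Pi.add_apply, ← hlogg, ← sub_eq_add_neg]
  exact abs_log_le_rpow_div_add hx (by positivity)
    (Real.rpow_le_one_of_one_le_of_nonpos (by simp) (by linarith [d.cast_nonneg (α := ℝ)])) hε

end MomentConditions

section Packing

lemma mul_one_sub_pow_le {q : ℝ} (hq : q ≤ 1) {k : ℕ} (hk : 0 < k) :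
    q * (1 - q) ^ k ≤ 1 / k := by
  have hpow : (1 - q) ^ k ≤ Real.exp (-(k * q)) := by
    simpa [← Real.exp_nat_mul] using
      pow_le_pow_left₀ (sub_nonneg.2 hq) (Real.one_sub_le_exp_neg q) k
  rw [le_div_iff₀ (by positivity)]
  calc q * (1 - q) ^ k * k = (k * q) * (1 - q) ^ k := by ring
    _ ≤ Real.exp (k * q) * Real.exp (-(k * q)) :=
        mul_le_mul (by linarith [Real.add_one_le_exp (k * q)]) hpow
          (pow_nonneg (sub_nonneg.2 hq) k) (Real.exp_pos _).le
    _ = 1 := by rw [← Real.exp_add, add_neg_cancel, Real.exp_zero]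

variable {α : Type*} [MeasurableSpace α] [PseudoMetricSpace α] [OpensMeasurableSpace α]
  [SecondCountableTopology α] (μ : Measure α) [IsProbabilityMeasure μ]

lemma setIntegral_compl_closedBall_pow_le {k : ℕ} (hk : 0 < k) {r : ℝ} {C : Set α}
    (hC : MeasurableSet C) (hdiam : ∀ x ∈ C, ∀ y ∈ C, dist x y ≤ r) :
    ∫ x in C, μ.real (Metric.closedBall x r)ᶜ ^ k ∂μ ≤ 1 / k := by
  calc ∫ x in C, μ.real (Metric.closedBall x r)ᶜ ^ k ∂μ
      ≤ ∫ _x in C, μ.real Cᶜ ^ k ∂μ := by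
        refine setIntegral_mono_on (integrable_measureReal_compl_closedBall_pow μ k r).integrableOn
          (integrable_const _) hC fun x hx => ?_
        exact pow_le_pow_left₀ measureReal_nonneg (measureReal_mono
          (Set.compl_subset_compl.2 fun y hy => hdiam y hy x hx)) k
    _ = μ.real C * (1 - μ.real C) ^ k := by
        rw [setIntegral_const, smul_eq_mul, probReal_compl_eq_one_sub hC]
    _ ≤ 1 / k := mul_one_sub_pow_le measureReal_le_one hk

lemma isolProb_le_setIntegral_add (k : ℕ) (r : ℝ) {S : Set α} (hS : MeasurableSet S) :
    isolProb μ k r ≤ ∫ x in S, μ.real (Metric.closedBall x r)ᶜ ^ k ∂μ + μ.real Sᶜ := by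
  have hint := integrable_measureReal_compl_closedBall_pow μ k r
  rw [isolProb, ← integral_add_compl hS hint]
  gcongr
  refine (setIntegral_mono_on (g := fun _ => 1) hint.integrableOn (integrable_const 1) hS.compl
    fun x _ => pow_le_one₀ measureReal_nonneg measureReal_le_one).trans_eq (by simp)

lemma isolProb_le_of_cover {ι : Type*} {k : ℕ} (hk : 0 < k) {r : ℝ} {S : Set α}
    (hS : MeasurableSet S) (s : Finset ι) {C : ι → Set α} (hC : ∀ i, MeasurableSet (C i))
    (hdiam : ∀ i, ∀ x ∈ C i, ∀ y ∈ C i, dist x y ≤ r) (hcover : S ⊆ ⋃ i ∈ s, C i) :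
    isolProb μ k r ≤ s.card / k + μ.real Sᶜ := by
  set φ : α → ℝ := fun x => μ.real (Metric.closedBall x r)ᶜ ^ k
  have hint : Integrable φ μ := integrable_measureReal_compl_closedBall_pow μ k r
  have hφ (x : α) : 0 ≤ φ x := by positivity
  refine (isolProb_le_setIntegral_add μ k r hS).trans (add_le_add_left ?_ _)
  calc ∫ x in S, φ x ∂μ ≤ ∫ x, ∑ i ∈ s, (C i).indicator φ x ∂μ := by
        rw [← integral_indicator hS]
        refine integral_mono (hint.indicator hS)
          (integrable_finsetSum _ fun i _ => hint.indicator (hC i)) fun x => ?_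
        have hnonneg : ∀ i ∈ s, 0 ≤ (C i).indicator φ x := fun i _ =>
          Set.indicator_nonneg (fun y _ => hφ y) x
        refine Set.indicator_apply_le' (fun hx => ?_) fun _ => Finset.sum_nonneg hnonneg
        obtain ⟨i, hi, hxi⟩ := Set.mem_iUnion₂.1 (hcover hx)
        exact (Set.indicator_of_mem hxi φ).symm.trans_le (Finset.single_le_sum hnonneg hi)
    _ = ∑ i ∈ s, ∫ x in C i, φ x ∂μ := by
        rw [integral_finsetSum _ fun i _ => hint.indicator (hC i)]
        simp only [integral_indicator (hC _)]
    _ ≤ ∑ _i ∈ s, (1 / k : ℝ) :=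
        Finset.sum_le_sum fun i _ => setIntegral_compl_closedBall_pow_le μ hk (hC i) (hdiam i)
    _ = s.card / k := by rw [Finset.sum_const, nsmul_eq_mul, mul_one_div]

lemma isolProb_le_two_mul_compl_closedBall {k : ℕ} (hk : 0 < k) (x₀ : α) (r : ℝ) :
    isolProb μ k r ≤ 2 * μ.real (Metric.closedBall x₀ (r / 2))ᶜ := by
  set S := Metric.closedBall x₀ (r / 2)
  have hS : MeasurableSet S := Metric.isClosed_closedBall.measurableSet
  have hinside : ∫ x in S, μ.real (Metric.closedBall x r)ᶜ ^ k ∂μ ≤ μ.real Sᶜ := by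
    calc ∫ x in S, μ.real (Metric.closedBall x r)ᶜ ^ k ∂μ ≤ ∫ _x in S, μ.real Sᶜ ∂μ := by
          refine setIntegral_mono_on
            (integrable_measureReal_compl_closedBall_pow μ k r).integrableOn
            (integrable_const _) hS fun x hx => ?_
          refine (pow_le_of_le_one measureReal_nonneg measureReal_le_one hk.ne').trans
            (measureReal_mono (Set.compl_subset_compl.2 fun y hy => ?_))
          have htri := dist_triangle_right y x x₀
          rw [Metric.mem_closedBall] at hx hy ⊢
          linarith
      _ ≤ μ.real Sᶜ := by
          rw [setIntegral_const, smul_eq_mul]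
          exact mul_le_of_le_one_left measureReal_nonneg measureReal_le_one
  linarith [isolProb_le_setIntegral_add μ k r hS]

end Packing

section Grid

variable {d : ℕ}

/-- The half-open cube of side `h` with lower corner `h z`. -/
def gridCell (h : ℝ) (z : Fin d → ℤ) : Set (E d) := {x | ∀ i, ⌊x i / h⌋ = z i}

lemma measurableSet_gridCell (h : ℝ) (z : Fin d → ℤ) : MeasurableSet (gridCell h z) := by
  have hm (i : Fin d) : Measurable fun x : E d => ⌊x i / h⌋ :=
    Int.measurable_floor.comp (by fun_prop)
  simp only [gridCell, Set.ofPred_forall]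
  exact .iInter fun i => hm i (measurableSet_singleton (z i))

lemma dist_le_of_mem_gridCell {h : ℝ} (hh : 0 < h) {z : Fin d → ℤ} {x y : E d}
    (hx : x ∈ gridCell h z) (hy : y ∈ gridCell h z) : dist x y ≤ d * h := by
  have hcoord (i : Fin d) : dist (x i) (y i) ≤ h := by
    have hfloor := Int.abs_sub_lt_one_of_floor_eq_floor ((hx i).trans (hy i).symm)
    rw [← sub_div, abs_div, abs_of_pos hh, div_lt_one hh] at hfloor
    exact hfloor.le
  rw [EuclideanSpace.dist_eq]
  refine Real.sqrt_le_iff.2 ⟨by positivity, ?_⟩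
  calc ∑ i, dist (x i) (y i) ^ 2 ≤ ∑ _i : Fin d, h ^ 2 :=
        Finset.sum_le_sum fun i _ => pow_le_pow_left₀ dist_nonneg (hcoord i) 2
    _ = d * h ^ 2 := by simp
    _ ≤ d ^ 2 * h ^ 2 := by
        gcongr
        exact_mod_cast Nat.le_self_pow two_ne_zero d
    _ = (d * h) ^ 2 := by ring

lemma closedBall_subset_iUnion_gridCell {h : ℝ} (hh : 0 < h) (l : ℝ) :
    Metric.closedBall (0 : E d) l ⊆
      ⋃ z ∈ Fintype.piFinset fun _ : Fin d => Finset.Icc (-(⌈l / h⌉₊ : ℤ)) ⌈l / h⌉₊,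
        gridCell h z := by
  intro x hx
  refine Set.mem_iUnion₂.2 ⟨fun i => ⌊x i / h⌋, Fintype.mem_piFinset.2 fun i => ?_, fun i => rfl⟩
  have hcoord : |x i / h| ≤ (⌈l / h⌉₊ : ℝ) := by
    rw [abs_div, abs_of_pos hh]
    exact (div_le_div_of_nonneg_right ((PiLp.norm_apply_le x i).trans
      (mem_closedBall_zero_iff.1 hx)) hh.le).trans (Nat.le_ceil _)
  obtain ⟨hlower, hupper⟩ := abs_le.1 hcoord
  refine Finset.mem_Icc.2 ⟨Int.le_floor.2 (by push_cast; exact hlower), ?_⟩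
  exact Int.floor_le_iff.2 (by push_cast; linarith)

lemma isolProb_le_packing (hd : 0 < d) (μ : Measure (E d)) [IsProbabilityMeasure μ] {k : ℕ}
    (hk : 0 < k) {r l : ℝ} (hr : 0 < r) (hr1 : r ≤ 1) (hl : 1 ≤ l) :
    isolProb μ k r
      ≤ ((2 * d + 3) * l) ^ d / (k * r ^ d) + μ.real (Metric.closedBall 0 l)ᶜ := by
  have hside : 0 < r / d := by positivity
  set K := ⌈l / (r / d)⌉₊ with hK
  refine (isolProb_le_of_cover μ hk Metric.isClosed_closedBall.measurableSet _
    (measurableSet_gridCell (r / d)) (fun z x hx y hy => ?_)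
    (closedBall_subset_iUnion_gridCell hside l)).trans (add_le_add_left ?_ _)
  · exact (dist_le_of_mem_gridCell hside hx hy).trans_eq (mul_div_cancel₀ _ (by positivity))
  · have hcells : (2 * K + 1) * r ≤ (2 * d + 3) * l := by
      have hceil : K < l / (r / d) + 1 := Nat.ceil_lt_add_one (by positivity)
      have hratio : l / (r / d) * r = l * d := by field_simp
      nlinarith
    have hcard : (Fintype.piFinset fun _ : Fin d => Finset.Icc (-(K : ℤ)) K).card
        = (2 * K + 1) ^ d := by
      rw [Fintype.card_piFinset_const, Int.card_Icc]
      congr 1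
      omega
    rw [← hK, hcard, div_le_div_iff₀ (by positivity) (by positivity)]
    calc (((2 * K + 1) ^ d : ℕ) : ℝ) * (k * r ^ d) = ((2 * K + 1) * r) ^ d * k := by
          rw [mul_pow]
          push_cast
          ring
      _ ≤ ((2 * d + 3) * l) ^ d * k := by gcongr

end Grid

section UpperTail

variable {d : ℕ}

lemma monotone_radius (d k : ℕ) : Monotone (radius d k) := fun s t h => by
  unfold radius
  gcongr

lemma radius_add (d k : ℕ) (s t : ℝ) : radius d k (s + t) = Real.exp (s / d) * radius d k t := by
  rw [radius, radius, ← Real.exp_add]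
  ring_nf

lemma compl_closedBall_subset_of_exp_le (hd : 0 < d) {s l : ℝ}
    (h : Real.exp (s / (4 * d)) ≤ 1 + l) :
    (Metric.closedBall (0 : E d) l)ᶜ ⊆ {x | s < 4 * d * Real.log (1 + ‖x‖)} := by
  intro x hx
  have hexp : Real.exp (s / (4 * d)) < 1 + ‖x‖ :=
    h.trans_lt (add_lt_add_right (by simpa using hx) 1)
  have hlog := (Real.lt_log_iff_exp_lt (by positivity)).2 hexp
  rw [div_lt_iff₀ (by positivity)] at hlog
  rw [Set.mem_ofPred_eq]
  linarith

variable (μ : Measure (E d)) [IsProbabilityMeasure μ]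

lemma isolProb_radius_le_of_radius_half_le_one (hd : 0 < d) {k : ℕ} (hk : 0 < k) {s : ℝ}
    (hs : 0 ≤ s) (hsmall : radius d k (s / 2) ≤ 1) :
    isolProb μ k (radius d k s) ≤ (2 * d + 3) ^ d * unitBallVolume d * Real.exp (-(s / 4))
      + μ.real (Metric.closedBall 0 (Real.exp (s / (4 * d))))ᶜ := by
  have hpow : Real.exp (s / (4 * d)) ^ d = Real.exp (s / 4) := by
    rw [← Real.exp_nat_mul]
    field_simp
  have hV := unitBallVolume_pos d
  have hr := radius_pos d k (s / 2)
  have hmass : k * radius d k (s / 2) ^ d = Real.exp (s / 2) / unitBallVolume d := by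
    rw [eq_div_iff hV.ne', mul_assoc, mul_radius_pow_mul hd hk]
  calc isolProb μ k (radius d k s) ≤ isolProb μ k (radius d k (s / 2)) :=
        isolProb_antitone μ k (monotone_radius d k (by linarith))
    _ ≤ ((2 * d + 3) * Real.exp (s / (4 * d))) ^ d / (k * radius d k (s / 2) ^ d)
        + μ.real (Metric.closedBall 0 (Real.exp (s / (4 * d))))ᶜ :=
        isolProb_le_packing hd μ hk hr hsmall (Real.one_le_exp (by positivity))
    _ = _ := by
        rw [hmass, mul_pow, hpow, show -(s / 4) = s / 4 - s / 2 by ring, Real.exp_sub]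
        field_simp

lemma isolProb_radius_le_of_one_le_radius_half {k : ℕ} (hk : 0 < k) {s : ℝ}
    (hlarge : 1 ≤ radius d k (s / 2)) :
    isolProb μ k (radius d k s)
      ≤ 2 * μ.real (Metric.closedBall 0 (Real.exp (s / (4 * d)) ^ 2 / 2))ᶜ := by
  have hexp : Real.exp (s / (4 * d)) ^ 2 ≤ radius d k s := by
    calc Real.exp (s / (4 * d)) ^ 2 = Real.exp (s / 2 / d) * 1 := by
          rw [← Real.exp_nat_mul, mul_one]
          ring_nf
      _ ≤ Real.exp (s / 2 / d) * radius d k (s / 2) := by gcongr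
      _ = radius d k s := by rw [← radius_add, add_halves]
  refine (isolProb_le_two_mul_compl_closedBall μ hk 0 _).trans ?_
  gcongr 2 * ?_
  exact measureReal_mono (Set.compl_subset_compl.2
    (Metric.closedBall_subset_closedBall (by linarith)))

lemma isolProb_radius_le (hd : 0 < d) {k : ℕ} (hk : 0 < k) {s : ℝ} (hs : 0 ≤ s) :
    isolProb μ k (radius d k s) ≤ (2 * d + 3) ^ d * unitBallVolume d * Real.exp (-(s / 4))
      + 2 * μ.real {x | s < 4 * d * Real.log (1 + ‖x‖)} := by
  have hV := unitBallVolume_pos d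
  rcases le_total (radius d k (s / 2)) 1 with hsmall | hlarge
  · refine (isolProb_radius_le_of_radius_half_le_one μ hd hk hs hsmall).trans
      (add_le_add_right ?_ _)
    exact (measureReal_mono (compl_closedBall_subset_of_exp_le hd (le_add_of_nonneg_left
      zero_le_one))).trans (le_mul_of_one_le_left measureReal_nonneg one_le_two)
  · refine (isolProb_radius_le_of_one_le_radius_half μ hk hlarge).trans
      (le_add_of_nonneg_of_le (by positivity) ?_)
    gcongr 2 * ?_
    refine measureReal_mono (compl_closedBall_subset_of_exp_le hd ?_)
    nlinarith [sq_nonneg (Real.exp (s / (4 * d)) - 1)]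

end UpperTail

section LowerTail

variable {d : ℕ} {f : E d → ℝ}

lemma one_sub_one_sub_pow_le {p ε : ℝ} (hp : 0 ≤ p) (hp1 : p ≤ 1) (hε : 0 < ε) (hε1 : ε ≤ 1)
    (k : ℕ) : 1 - (1 - p) ^ k ≤ (k * p) ^ ε := by
  have hbernoulli := one_add_mul_le_pow (a := -p) (by linarith) k
  have hpow : 0 ≤ (1 - p) ^ k := pow_nonneg (sub_nonneg.2 hp1) k
  rw [← sub_eq_add_neg] at hbernoulli
  rcases le_total (k * p) 1 with h | h
  · linarith [Real.self_le_rpow_of_le_one (by positivity) h hε1]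
  · linarith [Real.one_le_rpow h hε.le]

lemma natCast_mul_law_closedBall_radius (hd : 0 < d) (f : E d → ℝ) (x : E d) {k : ℕ} (hk : 0 < k)
    (s : ℝ) : k * law f (Metric.closedBall x (radius d k s))
      = ballMean f x (radius d k s) * ENNReal.ofReal (Real.exp s) := by
  rw [law_closedBall_eq_ballMean f x (radius_pos d k s), ← mul_radius_pow_mul hd hk,
    ENNReal.ofReal_mul (Nat.cast_nonneg k), ENNReal.ofReal_natCast, mul_left_comm]

lemma ofReal_one_sub_law_compl_closedBall_pow_le (hd : 0 < d) (hf : IsProbDensity f)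
    {ε R : ℝ} (hε : 0 < ε) (hε1 : ε ≤ 1) {k : ℕ} (hk : 0 < k) {s : ℝ} (hR : radius d k (-s) ≤ R)
    (x : E d) :
    ENNReal.ofReal (1 - (law f).real (Metric.closedBall x (radius d k (-s)))ᶜ ^ k)
      ≤ supMean f x R ^ ε * ENNReal.ofReal (Real.exp (-(ε * s))) := by
  have := hf.isProbabilityMeasure_law
  set r := radius d k (-s)
  set p := (law f).real (Metric.closedBall x r) with hp
  have hp0 : 0 ≤ p := measureReal_nonneg
  calc ENNReal.ofReal (1 - (law f).real (Metric.closedBall x r)ᶜ ^ k)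
      ≤ ENNReal.ofReal ((k * p) ^ ε) := by
        rw [probReal_compl_eq_one_sub Metric.isClosed_closedBall.measurableSet]
        exact ENNReal.ofReal_le_ofReal
          (one_sub_one_sub_pow_le hp0 measureReal_le_one hε hε1 k)
    _ = (k * law f (Metric.closedBall x r)) ^ ε := by
        rw [← ENNReal.ofReal_rpow_of_nonneg (by positivity) hε.le,
          ENNReal.ofReal_mul (Nat.cast_nonneg k), ENNReal.ofReal_natCast, hp,
          ofReal_measureReal]
    _ = ballMean f x r ^ ε * ENNReal.ofReal (Real.exp (-(ε * s))) := by
        rw [natCast_mul_law_closedBall_radius hd f x hk, ENNReal.mul_rpow_of_nonneg _ _ hε.le,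
          ENNReal.ofReal_rpow_of_pos (Real.exp_pos _), ← Real.exp_mul, neg_mul, mul_comm s]
    _ ≤ supMean f x R ^ ε * ENNReal.ofReal (Real.exp (-(ε * s))) := by
        gcongr
        exact ballMean_le_supMean f x ⟨radius_pos d k _, hR⟩

lemma IsProbDensity.sampleLaw_nearestDist_le (hd : 0 < d) (hf : IsProbDensity f)
    {ε R : ℝ} (hε : 0 < ε) (hε1 : ε ≤ 1) {n : ℕ} (i : Fin (n + 2)) {s : ℝ}
    (hR : radius d (n + 1) (-s) ≤ R) :
    sampleLaw (law f) (n + 2) {x | nearestDist x i ≤ radius d (n + 1) (-s)}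
      ≤ Q f ε R * ENNReal.ofReal (Real.exp (-(ε * s))) := by
  have := hf.isProbabilityMeasure_law
  set r := radius d (n + 1) (-s)
  have hint := integrable_measureReal_compl_closedBall_pow (law f) (n + 1) r
  have hprob : (sampleLaw (law f) (n + 2)).real {x | nearestDist x i ≤ r}
      = ∫ x, (1 - (law f).real (Metric.closedBall x r)ᶜ ^ (n + 1)) ∂law f := by
    rw [integral_sub (integrable_const 1) hint, ← isolProb, ← sampleLaw_real_lt_nearestDist _ n i,
      integral_const, probReal_univ, smul_eq_mul, one_mul,
      ← probReal_compl_eq_one_sub (measurableSet_lt_nearestDist r i)]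
    simp only [Set.compl_ofPred, not_lt]
  rw [← ofReal_measureReal, hprob, ofReal_integral_eq_lintegral_ofReal
    (by exact (integrable_const 1).sub hint) (ae_of_all _ fun x => sub_nonneg.2
      (pow_le_one₀ measureReal_nonneg measureReal_le_one)), Q, ← hf.lintegral_law,
    ← lintegral_mul_const' _ _ ENNReal.ofReal_ne_top]
  exact lintegral_mono fun x =>
    ofReal_one_sub_law_compl_closedBall_pow_le hd hf hε hε1 n.succ_pos hR x

end LowerTail

section UniformIntegrability

lemma lintegral_sq_eq_lintegral_meas_lt_mul {α : Type*} [MeasurableSpace α] (μ : Measure α)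
    {g : α → ℝ} (hg0 : ∀ a, 0 ≤ g a) (hg : AEMeasurable g μ) :
    ∫⁻ a, ENNReal.ofReal (g a ^ 2) ∂μ
      = 2 * ∫⁻ t in Set.Ioi (0 : ℝ), μ {a | t < g a} * ENNReal.ofReal t := by
  have h := lintegral_rpow_eq_lintegral_meas_lt_mul μ (ae_of_all _ hg0) hg two_pos
  have hsub : (2 : ℝ) - 1 = 1 := by norm_num
  simpa only [Real.rpow_two, hsub, Real.rpow_one, ENNReal.ofReal_ofNat] using h

lemma lintegral_sub_clamp_sq_le {α : Type*} [MeasurableSpace α] {π : Measure α} {Y : α → ℝ}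
    (hY : Measurable Y) {Ψ : ℝ → ℝ≥0∞} (hΨ : ∀ s, 0 ≤ s → π {a | s < |Y a|} ≤ Ψ s) {A : ℝ}
    (hA : 0 ≤ A) :
    ∫⁻ a, ENNReal.ofReal ((Y a - clamp A (Y a)) ^ 2) ∂π
      ≤ 2 * ∫⁻ u in Set.Ioi A, Ψ u * ENNReal.ofReal u := by
  have hmeas : Measurable fun a => |Y a - clamp A (Y a)| :=
    (hY.sub ((continuous_clamp A).measurable.comp hY)).abs
  have htail (t : ℝ) (ht : 0 < t) : π {a | t < |Y a - clamp A (Y a)|} ≤ Ψ (A + t) := by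
    refine (measure_mono fun a ha => ?_).trans (hΨ (A + t) (by positivity))
    rw [Set.mem_ofPred_eq, abs_sub_clamp hA] at ha
    grind
  calc ∫⁻ a, ENNReal.ofReal ((Y a - clamp A (Y a)) ^ 2) ∂π
      = ∫⁻ a, ENNReal.ofReal (|Y a - clamp A (Y a)| ^ 2) ∂π := by simp only [sq_abs]
    _ = 2 * ∫⁻ t in Set.Ioi (0 : ℝ), π {a | t < |Y a - clamp A (Y a)|} * ENNReal.ofReal t :=
        lintegral_sq_eq_lintegral_meas_lt_mul π (fun _ => abs_nonneg _) hmeas.aemeasurable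
    _ ≤ 2 * ∫⁻ t in Set.Ioi (0 : ℝ), Ψ (A + t) * ENNReal.ofReal (A + t) := by
        gcongr 2 * ?_
        refine setLIntegral_mono' measurableSet_Ioi fun t ht => ?_
        gcongr
        · exact htail t ht
        · linarith
    _ = 2 * ∫⁻ u in Set.Ioi A, Ψ u * ENNReal.ofReal u := by
        rw [← (measurePreserving_add_left volume A).setLIntegral_comp_preimage_emb
          (measurableEmbedding_addLeft A) (fun u => Ψ u * ENNReal.ofReal u) (Set.Ioi A),
          Set.preimage_const_add_Ioi, sub_self]

lemma tendsto_setLIntegral_Ioi {μ : Measure ℝ} {g : ℝ → ℝ≥0∞} {a : ℝ}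
    (h : ∫⁻ t in Set.Ioi a, g t ∂μ ≠ ∞) :
    Tendsto (fun A => ∫⁻ t in Set.Ioi A, g t ∂μ) atTop (𝓝 0) := by
  have hempty : ⋂ A : ℝ, Set.Ioi A = ∅ :=
    Set.eq_empty_of_forall_notMem fun t ht => lt_irrefl t (Set.mem_iInter.1 ht t)
  simp only [← withDensity_apply g measurableSet_Ioi] at h ⊢
  simpa only [hempty, measure_empty, Function.comp_def] using
    tendsto_measure_iInter_atTop (fun _ => measurableSet_Ioi.nullMeasurableSet)
      (fun _ _ => Set.Ioi_subset_Ioi) ⟨a, h⟩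

lemma sq_add_add_le (a b c : ℝ) : (a + b + c) ^ 2 ≤ 3 * (a ^ 2 + b ^ 2 + c ^ 2) := by
  nlinarith [sq_nonneg (a - b), sq_nonneg (a - c), sq_nonneg (b - c)]

lemma lintegral_sub_sq_le {Ω : Type*} [MeasurableSpace Ω] {P : Measure Ω} [IsProbabilityMeasure P]
    (Y : Ω → ℝ) {Z : Ω → ℝ} (hZ : Measurable Z) (b c : ℝ) :
    ∫⁻ ω, ENNReal.ofReal ((Y ω - c) ^ 2) ∂P
      ≤ 3 * (∫⁻ ω, ENNReal.ofReal ((Y ω - Z ω) ^ 2) ∂P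
        + ∫⁻ ω, ENNReal.ofReal ((Z ω - b) ^ 2) ∂P + ENNReal.ofReal ((b - c) ^ 2)) := by
  calc ∫⁻ ω, ENNReal.ofReal ((Y ω - c) ^ 2) ∂P
      ≤ ∫⁻ ω, 3 * (ENNReal.ofReal ((Y ω - Z ω) ^ 2) + ENNReal.ofReal ((Z ω - b) ^ 2)
          + ENNReal.ofReal ((b - c) ^ 2)) ∂P := by
        refine lintegral_mono fun ω => ?_
        rw [← ENNReal.ofReal_add (by positivity) (by positivity),
          ← ENNReal.ofReal_add (by positivity) (by positivity), ← ENNReal.ofReal_ofNat 3,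
          ← ENNReal.ofReal_mul (by norm_num)]
        refine ENNReal.ofReal_le_ofReal ?_
        have h := sq_add_add_le (Y ω - Z ω) (Z ω - b) (b - c)
        rwa [sub_add_sub_cancel, sub_add_sub_cancel] at h
    _ = _ := by
        rw [lintegral_const_mul' _ _ ENNReal.ofNat_ne_top, lintegral_add_right _ measurable_const,
          lintegral_add_right _ (by fun_prop), lintegral_const, measure_univ, mul_one]

lemma tendsto_lintegral_sub_sq_of_approx {Ω : ℕ → Type*} [∀ n, MeasurableSpace (Ω n)]
    {P : ∀ n, Measure (Ω n)} [∀ n, IsProbabilityMeasure (P n)] {Y : ∀ n, Ω n → ℝ}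
    {Z : ℝ → ∀ n, Ω n → ℝ} (hZ : ∀ A n, Measurable (Z A n)) {δ : ℝ → ℝ≥0∞}
    (hδ : Tendsto δ atTop (𝓝 0))
    (hYZ : ∀ᶠ A in atTop, ∀ᶠ n in atTop,
      ∫⁻ ω, ENNReal.ofReal ((Y n ω - Z A n ω) ^ 2) ∂P n ≤ δ A)
    {b : ℝ → ℝ} (hZb : ∀ᶠ A in atTop,
      Tendsto (fun n => ∫⁻ ω, ENNReal.ofReal ((Z A n ω - b A) ^ 2) ∂P n) atTop (𝓝 0))
    {c : ℝ} (hb : Tendsto b atTop (𝓝 c)) :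
    Tendsto (fun n => ∫⁻ ω, ENNReal.ofReal ((Y n ω - c) ^ 2) ∂P n) atTop (𝓝 0) := by
  have hbc : Tendsto (fun A => ENNReal.ofReal ((b A - c) ^ 2)) atTop (𝓝 0) := by
    simpa using ENNReal.tendsto_ofReal ((hb.sub_const c).pow 2)
  have hlimA : Tendsto (fun A => 3 * (δ A + 0 + ENNReal.ofReal ((b A - c) ^ 2))) atTop (𝓝 0) := by
    simpa using ENNReal.Tendsto.const_mul ((hδ.add_const 0).add hbc) (.inr ENNReal.ofNat_ne_top)
  rw [ENNReal.tendsto_nhds_zero]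
  intro η hη
  obtain ⟨A, hAη, hYZA, hZbA⟩ :=
    ((hlimA.eventually_lt_const hη).and (hYZ.and hZb)).exists
  have hlimn : Tendsto (fun n => 3 * (δ A + ∫⁻ ω, ENNReal.ofReal ((Z A n ω - b A) ^ 2) ∂P n
      + ENNReal.ofReal ((b A - c) ^ 2))) atTop
      (𝓝 (3 * (δ A + 0 + ENNReal.ofReal ((b A - c) ^ 2)))) :=
    ENNReal.Tendsto.const_mul ((hZbA.const_add _).add_const _) (.inr ENNReal.ofNat_ne_top)
  filter_upwards [hYZA, hlimn.eventually_lt_const hAη] with n hn hnη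
  refine (lintegral_sub_sq_le (Y n) (hZ A n) (b A) c).trans (le_trans ?_ hnη.le)
  gcongr

end UniformIntegrability

section TailBound

variable {d : ℕ} {f : E d → ℝ}

/-- A bound, uniform in the sample size, for the tail `P(|ξ_i| > s)` of the logarithm of the
rescaled volume of a nearest neighbour ball. The first term comes from the packing bound, the
second one from small balls, the third one from points far away from the origin. -/
def tailBound (f : E d → ℝ) (ε R s : ℝ) : ℝ≥0∞ :=
  ENNReal.ofReal ((2 * d + 3) ^ d * unitBallVolume d) * ENNReal.ofReal (Real.exp (-(s / 4)))
    + Q f ε R * ENNReal.ofReal (Real.exp (-(ε * s)))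
    + 2 * law f {x | s < 4 * d * Real.log (1 + ‖x‖)}

lemma IsProbDensity.sampleLaw_lt_abs_logSpacing_le (hd : 0 < d) (hf : IsProbDensity f)
    {ε R : ℝ} (hε : 0 < ε) (hε1 : ε ≤ 1) {n : ℕ} (hR : radius d (n + 1) 0 ≤ R) (i : Fin (n + 2))
    {s : ℝ} (hs : 0 ≤ s) :
    sampleLaw (law f) (n + 2) {x | s < |logSpacing x i|} ≤ tailBound f ε R s := by
  have := hf.isProbabilityMeasure_law
  set π := sampleLaw (law f) (n + 2)
  have hsplit : π {x | s < |logSpacing x i|}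
      ≤ π {x | radius d (n + 1) s < nearestDist x i}
        + π {x | nearestDist x i ≤ radius d (n + 1) (-s)} := by
    refine (measure_mono_ae ?_).trans (measure_union_le _ _)
    filter_upwards [hf.ae_nearestDist_pos hd n] with x hx
    intro (hsx : s < |logSpacing x i|)
    refine Or.imp (radius_lt_nearestDist_iff hd (hx i) s).2 (fun h => ?_) (lt_abs.1 hsx)
    refine not_lt.1 fun hlt : radius d (n + 1) (-s) < nearestDist x i => ?_
    linarith [(radius_lt_nearestDist_iff hd (hx i) (-s)).1 hlt]
  have hupper : π {x | radius d (n + 1) s < nearestDist x i}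
      ≤ ENNReal.ofReal ((2 * d + 3) ^ d * unitBallVolume d) * ENNReal.ofReal (Real.exp (-(s / 4)))
        + 2 * law f {x | s < 4 * d * Real.log (1 + ‖x‖)} := by
    have hV := unitBallVolume_pos d
    rw [← ofReal_measureReal, sampleLaw_real_lt_nearestDist (law f) n i,
      ← ENNReal.ofReal_mul (by positivity)]
    refine (ENNReal.ofReal_le_ofReal (isolProb_radius_le (law f) hd n.succ_pos hs)).trans ?_
    rw [ENNReal.ofReal_add (by positivity) (by positivity), ENNReal.ofReal_mul two_pos.le,
      ofReal_measureReal, ENNReal.ofReal_ofNat]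
  have hlower : π {x | nearestDist x i ≤ radius d (n + 1) (-s)}
      ≤ Q f ε R * ENNReal.ofReal (Real.exp (-(ε * s))) :=
    hf.sampleLaw_nearestDist_le hd hε hε1 i ((monotone_radius d (n + 1) (by linarith)).trans hR)
  calc π {x | s < |logSpacing x i|} ≤ _ := hsplit.trans (add_le_add hupper hlower)
    _ = tailBound f ε R s := add_right_comm _ _ _

lemma lintegral_exp_neg_mul_lt_top {a : ℝ} (ha : 0 < a) :
    ∫⁻ t in Set.Ioi (0 : ℝ), ENNReal.ofReal (Real.exp (-(a * t))) * ENNReal.ofReal t < ∞ := by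
  have h := integrableOn_rpow_mul_exp_neg_mul_rpow (s := 1) (by norm_num) one_pos ha
  refine lt_of_eq_of_lt (setLIntegral_congr_fun measurableSet_Ioi fun t _ => ?_)
    h.lintegral_lt_top
  simp only [Real.rpow_one, neg_mul]
  rw [← ENNReal.ofReal_mul (Real.exp_pos _).le, mul_comm]

lemma HasLogSqMoment.lintegral_law_lt_log_mul_lt_top (h : HasLogSqMoment f) {a : ℝ} (ha : 0 ≤ a) :
    ∫⁻ t in Set.Ioi (0 : ℝ), law f {x | t < a * Real.log (1 + ‖x‖)} * ENNReal.ofReal t < ∞ := by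
  have hlog (x : E d) : 0 ≤ Real.log (1 + ‖x‖) := Real.log_nonneg (by simp)
  have hcake := lintegral_sq_eq_lintegral_meas_lt_mul (law f)
    (g := fun x => a * Real.log (1 + ‖x‖)) (fun x => mul_nonneg ha (hlog x)) (by fun_prop)
  have hfin : ∫⁻ x, ENNReal.ofReal ((a * Real.log (1 + ‖x‖)) ^ 2) ∂law f < ∞ := by
    simp only [mul_pow, ENNReal.ofReal_mul (sq_nonneg a)]
    rw [lintegral_const_mul' _ _ ENNReal.ofReal_ne_top]
    exact ENNReal.mul_lt_top ENNReal.ofReal_lt_top h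
  rw [hcake] at hfin
  exact ENNReal.lt_top_of_mul_ne_top_right hfin.ne two_ne_zero

lemma HasLogSqMoment.lintegral_tailBound_lt_top (h : HasLogSqMoment f) {ε R : ℝ} (hε : 0 < ε)
    (hQ : Q f ε R < ∞) :
    ∫⁻ t in Set.Ioi (0 : ℝ), tailBound f ε R t * ENNReal.ofReal t < ∞ := by
  have hsplit (t : ℝ) : tailBound f ε R t * ENNReal.ofReal t
      = ENNReal.ofReal ((2 * d + 3) ^ d * unitBallVolume d)
          * (ENNReal.ofReal (Real.exp (-(1 / 4 * t))) * ENNReal.ofReal t)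
        + Q f ε R * (ENNReal.ofReal (Real.exp (-(ε * t))) * ENNReal.ofReal t)
        + 2 * (law f {x | t < 4 * d * Real.log (1 + ‖x‖)} * ENNReal.ofReal t) := by
    rw [tailBound, one_div_mul_eq_div]
    ring
  simp_rw [hsplit]
  rw [lintegral_add_left (by fun_prop), lintegral_add_left (by fun_prop),
    lintegral_const_mul' _ _ ENNReal.ofReal_ne_top, lintegral_const_mul' _ _ hQ.ne,
    lintegral_const_mul' _ _ ENNReal.ofNat_ne_top]
  exact ENNReal.add_lt_top.2 ⟨ENNReal.add_lt_top.2
    ⟨ENNReal.mul_lt_top ENNReal.ofReal_lt_top (lintegral_exp_neg_mul_lt_top (by norm_num)),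
      ENNReal.mul_lt_top hQ (lintegral_exp_neg_mul_lt_top hε)⟩,
    ENNReal.mul_lt_top ENNReal.ofNat_lt_top (h.lintegral_law_lt_log_mul_lt_top (by positivity))⟩

end TailBound

section Consistency

variable {d : ℕ} {f : E d → ℝ}

lemma lintegral_mean_sub_mean_sq_le {Ω : Type*} [MeasurableSpace Ω] {P : Measure Ω} {N : ℕ}
    {Y Z : Ω → Fin N → ℝ} (hY : ∀ i, Measurable fun ω => Y ω i)
    (hZ : ∀ i, Measurable fun ω => Z ω i) {δ : ℝ≥0∞}
    (h : ∀ i, ∫⁻ ω, ENNReal.ofReal ((Y ω i - Z ω i) ^ 2) ∂P ≤ δ) :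
    ∫⁻ ω, ENNReal.ofReal (((∑ i, Y ω i) / N - (∑ i, Z ω i) / N) ^ 2) ∂P ≤ δ := by
  have hmeas (i : Fin N) : Measurable fun ω => ENNReal.ofReal ((Y ω i - Z ω i) ^ 2) :=
    (((hY i).sub (hZ i)).pow_const 2).ennreal_ofReal
  rcases N.eq_zero_or_pos with rfl | hN
  · simp
  calc ∫⁻ ω, ENNReal.ofReal (((∑ i, Y ω i) / N - (∑ i, Z ω i) / N) ^ 2) ∂P
      ≤ ∫⁻ ω, (∑ i, ENNReal.ofReal ((Y ω i - Z ω i) ^ 2)) / (N : ℝ≥0∞) ∂P := by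
        refine lintegral_mono fun ω => ?_
        rw [← sub_div, ← Finset.sum_sub_distrib, ← ENNReal.ofReal_natCast,
          ← ENNReal.ofReal_sum_of_nonneg fun i _ => sq_nonneg _,
          ← ENNReal.ofReal_div_of_pos (Nat.cast_pos.2 hN)]
        refine ENNReal.ofReal_le_ofReal ?_
        simpa using sum_div_card_sq_le_sum_sq_div_card (s := Finset.univ)
          (f := fun i => Y ω i - Z ω i)
    _ = (∑ i, ∫⁻ ω, ENNReal.ofReal ((Y ω i - Z ω i) ^ 2) ∂P) / (N : ℝ≥0∞) := by
        simp_rw [div_eq_mul_inv]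
        rw [lintegral_mul_const _ (Finset.measurable_fun_sum _ fun i _ => hmeas i),
          lintegral_finsetSum _ fun i _ => hmeas i]
    _ ≤ δ := by
        refine ENNReal.div_le_of_le_mul ((Finset.sum_le_sum fun i _ => h i).trans_eq ?_)
        rw [Finset.sum_const, Finset.card_fin, nsmul_eq_mul, mul_comm]

lemma measurable_clamp_logSpacing (A : ℝ) {n : ℕ} (i : Fin (n + 2)) :
    Measurable fun x : Fin (n + 2) → E d => clamp A (logSpacing x i) :=
  (continuous_clamp A).measurable.comp (measurable_logSpacing i)

lemma IsProbDensity.tendsto_lintegral_mean_clamp_sub_sq (hd : 0 < d) (hf : IsProbDensity f)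
    (A : ℝ) :
    Tendsto (fun n : ℕ => ∫⁻ x, ENNReal.ofReal (((∑ i, clamp A (logSpacing x i)) / (n + 2 : ℕ)
      - ∫ t, clamp A t ∂limitLaw f) ^ 2) ∂sampleLaw (law f) (n + 2)) atTop (𝓝 0) := by
  have := hf.isProbabilityMeasure_law
  have hclamp (n : ℕ) (i : Fin (n + 2)) :
      MemLp (fun x => clamp A (logSpacing x i)) 2 (sampleLaw (law f) (n + 2)) :=
    .of_bound (measurable_clamp_logSpacing A i).aestronglyMeasurable |A|
      (ae_of_all _ fun x => abs_clamp_le_abs A _)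
  have hint (n : ℕ) : Integrable (fun x => ((∑ i, clamp A (logSpacing x i)) / (n + 2 : ℕ)
      - ∫ t, clamp A t ∂limitLaw f) ^ 2) (sampleLaw (law f) (n + 2)) := by
    simp only [div_eq_mul_inv]
    exact (((memLp_finsetSum _ fun i _ => hclamp n i).mul_const _).sub
      (memLp_const _)).integrable_sq
  have h := ENNReal.tendsto_ofReal (hf.tendsto_integral_mean_clamp_sub_sq hd A)
  rw [ENNReal.ofReal_zero] at h
  refine h.congr fun n => ?_
  exact ofReal_integral_eq_lintegral_ofReal (hint n) (ae_of_all _ fun x => sq_nonneg _)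

lemma IsProbDensity.tendsto_lintegral_mean_logSpacing_sub_sq (hd : 0 < d) (hf : IsProbDensity f)
    (hlog : HasLogSqMoment f) {ε R : ℝ} (hε : 0 < ε) (hε1 : ε ≤ 1) (hR : 0 < R)
    (hQ : Q f ε R < ∞) :
    Tendsto (fun n : ℕ => ∫⁻ x, ENNReal.ofReal (((∑ i, logSpacing x i) / (n + 2 : ℕ)
      - (entropy f - eulerConstant)) ^ 2) ∂sampleLaw (law f) (n + 2)) atTop (𝓝 0) := by
  have := hf.isProbabilityMeasure_law
  have hH := hf.hasFiniteEntropy hd hlog hε hR hQ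
  have htail : Tendsto (fun A => 2 * ∫⁻ u in Set.Ioi A, tailBound f ε R u * ENNReal.ofReal u) atTop
      (𝓝 0) := by
    simpa using ENNReal.Tendsto.const_mul (a := 2)
      (tendsto_setLIntegral_Ioi (hlog.lintegral_tailBound_lt_top hε hQ).ne)
      (.inr ENNReal.ofNat_ne_top)
  have hradius : ∀ᶠ n : ℕ in atTop, radius d (n + 1) 0 ≤ R :=
    (((tendsto_radius hd 0).comp (tendsto_add_atTop_nat 1)).mono_right
      nhdsWithin_le_nhds).eventually_le_const hR
  refine tendsto_lintegral_sub_sq_of_approx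
    (Z := fun A n x => (∑ i, clamp A (logSpacing x i)) / (n + 2 : ℕ))
    (fun A n => (Finset.measurable_fun_sum _ fun i _ =>
      measurable_clamp_logSpacing A i).div_const _) htail ?_
    (Eventually.of_forall (hf.tendsto_lintegral_mean_clamp_sub_sq hd)) ?_
  · filter_upwards [eventually_ge_atTop 0] with A hA
    filter_upwards [hradius] with n hn
    exact lintegral_mean_sub_mean_sq_le measurable_logSpacing (measurable_clamp_logSpacing A)
      fun i => lintegral_sub_clamp_sq_le (measurable_logSpacing i)
        (fun s hs => hf.sampleLaw_lt_abs_logSpacing_le hd hε hε1 hn i hs) hA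
  · rw [← hf.integral_limitLaw hH]
    exact tendsto_integral_clamp (hf.integrable_id_limitLaw hH)

lemma klEstimate_eq {n : ℕ} {x : Fin (n + 2) → E d} (h : ∀ i, 0 < nearestDist x i) :
    klEstimate x = (∑ i, logSpacing x i) / (n + 2 : ℕ) + eulerConstant := by
  have hcast : ((n + 2 : ℕ) : ℝ) - 1 = (n + 1 : ℕ) := by push_cast; ring
  rw [klEstimate, hcast, Real.log_rpow (Finset.prod_pos fun i _ => h i),
    Real.log_prod fun i _ => (h i).ne']
  simp only [logSpacing, Finset.sum_add_distrib, Finset.sum_const, Finset.card_univ,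
    Fintype.card_fin, nsmul_eq_mul, ← Finset.mul_sum]
  field_simp
  ring

lemma measurable_klEstimate (N : ℕ) : Measurable (klEstimate : (Fin N → E d) → ℝ) := by
  have hprod : Measurable fun x : Fin N → E d => ∏ i, nearestDist x i :=
    Finset.measurable_fun_prod _ fun i _ => measurable_nearestDist i
  unfold klEstimate
  fun_prop

lemma IsProbDensity.tendsto_lintegral_klEstimate_sub_sq (hd : 0 < d) (hf : IsProbDensity f)
    (hlog : HasLogSqMoment f) {ε R : ℝ} (hε : 0 < ε) (hR : 0 < R) (hQ : Q f ε R < ∞) :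
    Tendsto (fun n : ℕ => ∫⁻ x, ENNReal.ofReal ((klEstimate x - entropy f) ^ 2)
      ∂sampleLaw (law f) (n + 2)) atTop (𝓝 0) := by
  refine (hf.tendsto_lintegral_mean_logSpacing_sub_sq hd hlog (lt_min hε one_pos)
    (min_le_right _ _) hR (hf.Q_min_one_lt_top hε.le hQ)).congr fun n => lintegral_congr_ae ?_
  filter_upwards [hf.ae_nearestDist_pos hd n] with x hx
  rw [klEstimate_eq hx, sub_sub_eq_add_sub]

lemma l2Consistent_iff {Ω : Type*} [MeasurableSpace Ω] {P : Measure Ω} {X : ℕ → Ω → E d}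
    (hX : ∀ i, HasLaw (X i) (law f) P) (hindep : iIndepFun X P) :
    L2Consistent P X f ↔
      Tendsto (fun n : ℕ => ∫⁻ x, ENNReal.ofReal ((klEstimate x - entropy f) ^ 2)
        ∂sampleLaw (law f) (n + 2)) atTop (𝓝 0) := by
  rw [L2Consistent, ← tendsto_add_atTop_iff_nat 2]
  refine tendsto_congr fun n => ?_
  have hlaw : HasLaw (fun ω (i : Fin (n + 2)) => X i ω) (sampleLaw (law f) (n + 2)) P :=
    (hindep.precomp Fin.val_injective).hasLaw_pi fun i => hX i
  exact hlaw.lintegral_comp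
    (((measurable_klEstimate _).sub_const _).pow_const 2).ennreal_ofReal.aemeasurable

end Consistency

end KozachenkoLeonenko

end

open KozachenkoLeonenko in
theorem corollary3_general {d : ℕ} (hd : 0 < d) {Ω : Type*} [MeasurableSpace Ω] {P : Measure Ω}
    {X : ℕ → Ω → E d} {f : E d → ℝ} (hf : IsProbDensity f) (hX : ∀ i, HasLaw (X i) (law f) P)
    (hindep : iIndepFun X P) (hlog : HasLogSqMoment f)
    (hQ : ∃ ε R : ℝ, 0 < ε ∧ 0 < R ∧ Q f ε R < ∞) :
    HasFiniteEntropy f ∧ L2Consistent P X f := by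
  obtain ⟨ε, R, hε, hR, hQ⟩ := hQ
  exact ⟨hf.hasFiniteEntropy hd hlog hε hR hQ,
    (l2Consistent_iff hX hindep).2 (hf.tendsto_lintegral_klEstimate_sub_sq hd hlog hε hR hQ)⟩

theorem corollary3 {d : ℕ} (hd : 0 < d)
    {Ω : Type*} [MeasurableSpace Ω] (P : Measure Ω) [IsProbabilityMeasure P]
    (X : ℕ → Ω → KozachenkoLeonenko.E d) (f : KozachenkoLeonenko.E d → ℝ)
    (hf : KozachenkoLeonenko.IsProbDensity f)
    (hX : ∀ i, Measurable (X i))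
    (hlaw : ∀ i, P.map (X i) = volume.withDensity (fun x => ENNReal.ofReal (f x)))
    (hindep : iIndepFun X P) :
    (((∃ ε₀ : ℝ, 0 < ε₀ ∧ KozachenkoLeonenko.K₂ f ε₀ < ∞) ∨
          (∃ p : ℝ, 2 < p ∧ KozachenkoLeonenko.logMoment f p < ∞)) →
        ((∃ ε₁ R₁ : ℝ, 0 < ε₁ ∧ 0 < R₁ ∧ KozachenkoLeonenko.Q f ε₁ R₁ < ∞) ∨
          KozachenkoLeonenko.CondB f) →
        ((∃ ε₂ R₂ : ℝ, 0 < ε₂ ∧ 0 < R₂ ∧ KozachenkoLeonenko.T f ε₂ R₂ < ∞) ∨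
          KozachenkoLeonenko.CondC1 f) →
        KozachenkoLeonenko.HasFiniteEntropy f ∧ KozachenkoLeonenko.L2Consistent P X f) ∧
      (KozachenkoLeonenko.CondB f → KozachenkoLeonenko.CondC1 f →
        KozachenkoLeonenko.HasBoundedSupport f →
        KozachenkoLeonenko.HasFiniteEntropy f ∧ KozachenkoLeonenko.L2Consistent P X f) := by
  have hX' (i : ℕ) : HasLaw (X i) (KozachenkoLeonenko.law f) P := ⟨(hX i).aemeasurable, hlaw i⟩
  refine ⟨fun hK hQ _ => corollary3_general hd hf hX' hindep ?_
      (hQ.elim id (·.exists_Q_lt_top hd hf)),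
    fun hB _ hS => corollary3_general hd hf hX' hindep
      (hS.hasLogSqMoment hf) (hB.exists_Q_lt_top hd hf)⟩
  rcases hK with ⟨ε, hε, hK⟩ | ⟨p, hp, hp_lt⟩
  · exact hf.hasLogSqMoment_of_K₂ (neg_one_lt_zero.trans hε) hK
  · exact hf.hasLogSqMoment_of_logMoment hp.le hp_lt
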